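/- Let $n\ge 2$, $2\le r\le\infty$, and let $(\overline M,g)$ be a spacetime-with-timelike-boundary: $\overline M$ is a connected $n$-dimensional $C^r$ manifold-with-boundary (possibly with empty boundary), $g$ is a $C^1$ Lorentzian metric on $\overline M$ whose pullback to $\partial M$ is Lorentzian, and a time-orientation (a future timelike cone at each point, selected locally by a continuous timelike vector field) is fixed. Causal vectors are nonzero. A continuous curve $\gamma:[\tau_0,\tau_1]\to\overline M$, $\tau_0<\tau_1$, is *future-directed $H^1$-causal* if $\varphi\circ\gamma|_J$ is absolutely continuous with $L^2$ derivative for every $C^r$ chart $(U,\varphi)$ and every compact interval $J\subset\gamma^{-1}(U)$, and $\gamma'$ is future-directed causal a.e. A *local temporal function* is a $C^r$ function $\tau:U\to\mathbb R$ on an open set $U\subset\overline M$ whose gradient is timelike and past-directed. Call a future-directed $H^1$-causal curve $\gamma$ *$H^1$-timelike* if, for every local temporal function $\tau:U\to\mathbb R$ and every nondegenerate compact interval $[c,d]\subset[\tau_0,\tau_1]$ with $\gamma([c,d])\subset U$, the reparametrization $\sigma:[\tau(\gamma(c)),\tau(\gamma(d))]\to\overline M$ of $\gamma|_{[c,d]}$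 by $\tau$ (that is, $\sigma(\tau(\gamma(t)))=\gamma(t)$ for $t\in[c,d]$) satisfies $g(\sigma',\sigma')<-\nu$ a.e. for some $\nu>0$. Let $p,q\in\overline M$ (points of $\partial M$ being allowed). If there is a future-directed $H^1$-timelike curve from $p$ to $q$ (which may touch $\partial M$), then there is a future-directed timelike piecewise smooth curve in $\overline M$ from $p$ to $q$, that is, a continuous curve on some $[a,b]$, $a<b$, which is $C^r$ on each closed interval of a finite partition of $[a,b]$ with future-directed timelike velocity everywhere (one-sided at the partition points). Consequently the two chronological relations coincide: for all $p,q\in\overline M$, there is a future-directed $H^1$-timelike curve from $p$ to $q$ if and only if there is a future-directed timelike piecewise smooth curve from $p$ to $q$. -/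

import Mathlib

open Set MeasureTheory
open scoped Manifold ContDiff

namespace SpacetimeWithBoundary

noncomputable section

/-- The restriction of the bilinear form `B` to the subspace `W` is a Lorentzian scalar product
(signature `(-, +, …, +)`): it is symmetric, and `W` contains a vector `T` with `B T T < 0` whose
orthogonal complement in `W` is positive definite. -/
def IsLorentzianOn {V : Type*} [AddCommGroup V] [Module ℝ V] [TopologicalSpace V]
    (B : V →L[ℝ] V →L[ℝ] ℝ) (W : Submodule ℝ V) : Prop :=
  (∀ v ∈ W, ∀ w ∈ W, B v w = B w v) ∧
    ∃ T ∈ W, B T T < 0 ∧ ∀ v ∈ W, B T v = 0 → v ≠ 0 → 0 < B v v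

section Manifold

variable {n : ℕ} [NeZero n] {M : Type*} [TopologicalSpace M]
  [ChartedSpace (EuclideanHalfSpace n) M]

/-- The tangent space `T_p ∂M ⊆ T_p M` of the boundary at a boundary point `p`: the kernel of the
differential at `p` of the boundary defining coordinate `x⁰ ≥ 0` of the chart at `p`. -/
def boundaryTangentSpace (p : M) : Submodule ℝ (TangentSpace (𝓡∂ n) p) :=
  LinearMap.ker (mfderiv (𝓡∂ n) 𝓘(ℝ, ℝ) (fun x : M ↦ (extChartAt (𝓡∂ n) p x) 0) p).toLinearMap

/-- `v` is the velocity at the parameter `t` of the curve `γ`, with respect to parameters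
in `s`; one-sided when `t` is an endpoint of the interval `s`. -/
def HasVelocityWithinAt (γ : ℝ → M) (s : Set ℝ) (t : ℝ) (v : TangentSpace (𝓡∂ n) (γ t)) : Prop :=
  HasMFDerivWithinAt 𝓘(ℝ, ℝ) (𝓡∂ n) γ s t ((1 : ℝ →L[ℝ] ℝ).smulRight v)

/-- `H¹([c, d], ℝⁿ)`: absolutely continuous with square integrable derivative. -/
def IsH1On (f : ℝ → EuclideanSpace ℝ (Fin n)) (c d : ℝ) : Prop :=
  AbsolutelyContinuousOnInterval f c d ∧ MemLp (deriv f) 2 (volume.restrict (Icc c d))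

/-- `γ : [a, b] → M` is an `H¹`-curve: it is continuous and its coordinate expression
in every chart `e` of the (maximal) `C^r` atlas is `H¹` on each compact interval that
`γ` maps into the domain of `e`. -/
def IsH1Curve (r : ℕ∞) (γ : ℝ → M) (a b : ℝ) : Prop :=
  ContinuousOn γ (Icc a b) ∧
    ∀ e ∈ IsManifold.maximalAtlas (𝓡∂ n) r M, ∀ c d : ℝ, a ≤ c → c ≤ d → d ≤ b →
      MapsTo γ (Icc c d) e.source → IsH1On (fun t ↦ e.extend (𝓡∂ n) (γ t)) c d

variable [IsManifold (𝓡∂ n) 1 M]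

variable (n M) in
/-- A `C¹` Lorentzian metric on the manifold-with-boundary `M`. -/
structure LorentzMetric where
  /-- the scalar product on each tangent space -/
  val (p : M) : TangentSpace (𝓡∂ n) p →L[ℝ] TangentSpace (𝓡∂ n) p →L[ℝ] ℝ
  lorentzian (p : M) : IsLorentzianOn (val p) ⊤
  contMDiff : ContMDiff (𝓡∂ n)
    ((𝓡∂ n).prod 𝓘(ℝ, EuclideanSpace ℝ (Fin n) →L[ℝ] EuclideanSpace ℝ (Fin n) →L[ℝ] ℝ)) 1
    (fun p : M ↦ Bundle.TotalSpace.mk'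
      (EuclideanSpace ℝ (Fin n) →L[ℝ] EuclideanSpace ℝ (Fin n) →L[ℝ] ℝ)
      (E := fun p : M ↦ TangentSpace (𝓡∂ n) p →L[ℝ] TangentSpace (𝓡∂ n) p →L[ℝ] ℝ) p (val p))

/-- The boundary is timelike: the pullback of the metric to `∂M` is Lorentzian. -/
def LorentzMetric.HasTimelikeBoundary (g : LorentzMetric n M) : Prop :=
  ∀ p ∈ (𝓡∂ n).boundary M, IsLorentzianOn (g.val p) (boundaryTangentSpace p)

/-- A time-orientation: a choice of one (the future) of the two cones of timelike vectors in each
tangent space, selected near every point by a continuous timelike vector field. -/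
structure TimeOrientation (g : LorentzMetric n M) where
  /-- the cone of future-directed timelike vectors -/
  cone (p : M) : Set (TangentSpace (𝓡∂ n) p)
  continuously_chosen : ∀ p : M, ∃ U : Set M, IsOpen U ∧ p ∈ U ∧
    ∃ X : ∀ q : M, TangentSpace (𝓡∂ n) q,
      ContinuousOn (fun q ↦ (⟨q, X q⟩ : TangentBundle (𝓡∂ n) M)) U ∧
      ∀ q ∈ U, g.val q (X q) (X q) < 0 ∧
        cone q = {v | g.val q v v < 0 ∧ g.val q (X q) v < 0}

variable {g : LorentzMetric n M}

/-- `v` is a future-directed causal (i.e. timelike or lightlike, hence nonzero) vector. -/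
def TimeOrientation.FutureCausal (o : TimeOrientation g) {p : M} (v : TangentSpace (𝓡∂ n) p) :
    Prop :=
  v ≠ 0 ∧ g.val p v v ≤ 0 ∧ ∀ w ∈ o.cone p, g.val p w v < 0

/-- `τ` is a temporal function on the open set `U`: it is `C^r`, and its gradient
(the vector `w` with `g(w, ·) = dτ`) is timelike and past-directed on `U`. -/
def TimeOrientation.IsTemporalOn (o : TimeOrientation g) (r : ℕ∞) (τ : M → ℝ) (U : Set M) :
    Prop :=
  IsOpen U ∧ ContMDiffOn (𝓡∂ n) 𝓘(ℝ, ℝ) r τ U ∧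
    ∀ p ∈ U, ∃ w : TangentSpace (𝓡∂ n) p,
      (∀ v : TangentSpace (𝓡∂ n) p, g.val p w v = mfderiv (𝓡∂ n) 𝓘(ℝ, ℝ) τ p v) ∧ -w ∈ o.cone p

/-- `γ : [a, b] → M` is a future-directed `H¹`-causal curve. -/
def TimeOrientation.IsFutureH1Causal (o : TimeOrientation g) (r : ℕ∞) (γ : ℝ → M) (a b : ℝ) :
    Prop :=
  IsH1Curve (n := n) r γ a b ∧ ∀ᵐ t ∂(volume.restrict (Icc a b)),
    ∃ v : TangentSpace (𝓡∂ n) (γ t), HasVelocityWithinAt γ (Icc a b) t v ∧ o.FutureCausal v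

/-- The curve `γ : [a, b] → M` satisfies `g(γ', γ') < -ν` a.e. for some `ν > 0` whenever it is
parametrized by a local temporal function: for every temporal function `τ` on an
open set `U`, every compact interval `[c, d]` mapped by `γ` into `U`, and the reparametrization
`σ` of `γ|[c, d]` by `τ` (that is `σ : [τ(γ c), τ(γ d)] → M` with `σ (τ (γ t)) = γ t`). -/
def TimeOrientation.IsUniformlyTimelike (o : TimeOrientation g) (r : ℕ∞) (γ : ℝ → M) (a b : ℝ) :
    Prop :=
  ∀ (U : Set M) (τ : M → ℝ), o.IsTemporalOn r τ U →
    ∀ c d : ℝ, a ≤ c → c < d → d ≤ b → MapsTo γ (Icc c d) U →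
      ∀ σ : ℝ → M, (∀ t ∈ Icc c d, σ (τ (γ t)) = γ t) →
        ∃ ν : ℝ, 0 < ν ∧ ∀ᵐ s ∂(volume.restrict (Icc (τ (γ c)) (τ (γ d)))),
          ∃ v : TangentSpace (𝓡∂ n) (σ s),
            HasVelocityWithinAt σ (Icc (τ (γ c)) (τ (γ d))) s v ∧ g.val (σ s) v v < -ν

/-- There is a future-directed `H¹`-timelike curve from `p` to `q`. -/
def TimeOrientation.H1Chronological (o : TimeOrientation g) (r : ℕ∞) (p q : M) : Prop :=
  ∃ (a b : ℝ) (γ : ℝ → M), a < b ∧ γ a = p ∧ γ b = q ∧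
    o.IsFutureH1Causal r γ a b ∧ o.IsUniformlyTimelike r γ a b

/-- `α : [a, b] → M` is a future-directed timelike piecewise smooth (i.e. `C^r`) curve: for some
partition `a = t 0 < ⋯ < t k = b`, it is `C^r` on each closed piece, with future-directed timelike
velocity everywhere (one-sided at the ends of the piece). -/
def TimeOrientation.IsPiecewiseSmoothTimelike (o : TimeOrientation g) (r : ℕ∞) (α : ℝ → M)
    (a b : ℝ) : Prop :=
  ∃ (k : ℕ) (t : ℕ → ℝ), t 0 = a ∧ t k = b ∧ ∀ i < k, t i < t (i + 1) ∧
    ContMDiffOn 𝓘(ℝ, ℝ) (𝓡∂ n) r α (Icc (t i) (t (i + 1))) ∧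
    ∀ s ∈ Icc (t i) (t (i + 1)), ∃ v : TangentSpace (𝓡∂ n) (α s),
      HasVelocityWithinAt α (Icc (t i) (t (i + 1))) s v ∧ v ∈ o.cone (α s)

/-- The chronological relation `p ≪ q`: there is a future-directed timelike piecewise smooth
curve from `p` to `q`. -/
def TimeOrientation.Chronological (o : TimeOrientation g) (r : ℕ∞) (p q : M) : Prop :=
  ∃ (a b : ℝ) (α : ℝ → M), a < b ∧ α a = p ∧ α b = q ∧ o.IsPiecewiseSmoothTimelike r α a b

end Manifold

end

end SpacetimeWithBoundary

/-!
Both directions are local, and neither uses that the boundary is timelike: charts of a manifold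
with boundary take values in a half-space, which is convex, so that straight segments between
points of a small ball of a chart never leave the manifold.

From `H¹`-timelike to piecewise smooth curves: around a point `x₀ = γ t₀`, let `G p` be the metric
at `p` in the chart of `x₀` and let `T` be a constant vector that is future timelike at `x₀`. The
linear function `-G x₀ (T, ·)` of the coordinates is a temporal function near `x₀`
(`TimeOrientation.exists_isTemporalOn_linear`), and it is absolutely continuous with positive
derivative along `γ`. So `γ` can be reparametrized by it, and the hypothesis, pulled back to the
original parameter, gives `ν > 0` with `G (γ t) (u, u) < -ν (G x₀ (T, u))²` for almost every
coordinate velocity `u` (`TimeOrientation.IsUniformlyTimelike.exists_chart_velocity_bound`). As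
`G` is continuous at `x₀`, `u` then satisfies the same bound for `G x₀` with `ν / 2` on a smaller
neighbourhood (`IsLorentzianOn.exists_stable`). That bound cuts out a closed convex cone, by the
Cauchy-Schwarz inequality on the complement of `T`, so the coordinate displacement of `γ` lies in
the cone as well (`IsLorentzianOn.displacement_timelike`). By stability again, the straight segment
with this displacement is timelike at each of its points. Finitely many such segments replace `γ`.

Conversely, a piecewise smooth timelike curve is Lipschitz in every chart. A temporal function `τ`
has positive derivative along each piece, where by compactness `g(v, v) / (dτ v)²` is bounded away
from zero for the velocity `v`; the velocity of the reparametrization by `τ` is `v / dτ v`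
(`TimeOrientation.IsTemporalOn.strictMonoOn_and_bound`,
`TimeOrientation.IsPiecewiseSmoothTimelike.isUniformlyTimelike`).
-/

namespace SpacetimeWithBoundary

/-! ### Lorentzian scalar products -/

section LorentzAlgebra

variable {V : Type*} [AddCommGroup V] [Module ℝ V] [TopologicalSpace V] {B : V →L[ℝ] V →L[ℝ] ℝ}

theorem IsLorentzianOn.comm (hB : IsLorentzianOn B ⊤) (v w : V) : B v w = B w v :=
  hB.1 v trivial w trivial

/-- The orthogonal complement of *every* timelike vector is positive definite. Otherwise that
vector and a causal vector orthogonal to it would span a negative semidefinite plane, and the plane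
would meet the positive definite hyperplane given by the definition. -/
theorem IsLorentzianOn.pos_of_orthogonal (hB : IsLorentzianOn B ⊤) {T u : V} (hT : B T T < 0)
    (hTu : B T u = 0) (hu : u ≠ 0) : 0 < B u u := by
  obtain ⟨S, -, hS, hpos⟩ := hB.2
  by_contra! hneg
  have huT : B u T = 0 := by rw [hB.comm, hTu]
  have hz : B S (B S u • T - B S T • u) = 0 := by simp; ring
  by_cases h0 : B S u • T - B S T • u = 0
  · have h1 : B T (B S u • T - B S T • u) = 0 := by rw [h0, map_zero]
    have h2 : B S u = 0 := by
      simp only [map_sub, map_smul, smul_eq_mul, hTu, mul_zero, sub_zero, mul_eq_zero] at h1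
      exact h1.resolve_right hT.ne
    exact absurd (hpos u trivial h2 hu) (not_lt.2 hneg)
  · have h1 := hpos _ trivial hz h0
    simp only [map_sub, map_smul, smul_eq_mul, _root_.sub_apply,
      _root_.smul_apply, hTu, huT] at h1
    nlinarith [mul_nonneg (sq_nonneg (B S u)) (neg_nonneg.2 hT.le),
      mul_nonneg (sq_nonneg (B S T)) (neg_nonneg.2 hneg)]

theorem IsLorentzianOn.nonneg_of_orthogonal (hB : IsLorentzianOn B ⊤) {T u : V} (hT : B T T < 0)
    (hTu : B T u = 0) : 0 ≤ B u u := by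
  rcases eq_or_ne u 0 with rfl | hu
  · simp
  · exact (hB.pos_of_orthogonal hT hTu hu).le

/-- Having a negative product with a given timelike vector `T` is, among causal vectors, the same
as lying in the same cone as `T`; hence the products between such vectors are negative too. -/
theorem IsLorentzianOn.neg_of_same_cone (hB : IsLorentzianOn B ⊤) {T u v : V} (hT : B T T < 0)
    (hu : B u u < 0) (hTu : B T u < 0) (hv : B v v ≤ 0) (hTv : B T v < 0) : B u v < 0 := by
  have h := hB.nonneg_of_orthogonal (u := B T v • u - B T u • v) hT (by simp; ring)
  simp only [map_sub, map_smul, smul_eq_mul, _root_.sub_apply,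
      _root_.smul_apply, hB.comm v u] at h
  have h1 : 0 < B T v * B T u := mul_pos_of_neg_of_neg hTv hTu
  have h2 : B T v ^ 2 * B u u < 0 := mul_neg_of_pos_of_neg (sq_pos_of_neg hTv) hu
  have h3 : B T u ^ 2 * B v v ≤ 0 := mul_nonpos_of_nonneg_of_nonpos (sq_nonneg _) hv
  by_contra! hc
  nlinarith [mul_nonneg h1.le hc]

/-- A covector without causal vectors in its kernel has a timelike gradient `z`. -/
theorem IsLorentzianOn.timelike_of_kernel (hB : IsLorentzianOn B ⊤) {z : V}
    (h : ∀ u, u ≠ 0 → B u u ≤ 0 → B z u ≠ 0) : B z z < 0 := by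
  obtain ⟨T, -, hT, -⟩ := hB.2
  have hzT : B z T ≠ 0 := h T (by rintro rfl; simp at hT) hT.le
  have hz0 : z ≠ 0 := by rintro rfl; simp at hzT
  by_contra! hzz
  rcases hzz.eq_or_lt with hzz | hzz
  · exact h z hz0 hzz.symm.le hzz.symm
  · -- the projection of `T` to the complement of a spacelike `z` would be a timelike vector there
    have hk : B z (B z z • T - B z T • z) = 0 := by simp; ring
    by_cases h0 : B z z • T - B z T • z = 0
    · have h1 : B T (B z z • T - B z T • z) = 0 := by rw [h0, map_zero]
      simp only [map_sub, map_smul, smul_eq_mul, hB.comm T z] at h1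
      nlinarith [mul_neg_of_pos_of_neg hzz hT, sq_nonneg (B z T)]
    · refine h _ h0 ?_ hk
      simp only [map_sub, map_smul, smul_eq_mul, _root_.sub_apply,
        _root_.smul_apply, hB.comm T z]
      nlinarith [mul_neg_of_pos_of_neg (mul_pos hzz hzz) hT, mul_nonneg hzz.le (sq_nonneg (B z T))]

end LorentzAlgebra

section LorentzNormed

variable {V : Type*} [NormedAddCommGroup V] [NormedSpace ℝ V] {B : V →L[ℝ] V →L[ℝ] ℝ}

theorem IsLorentzianOn.exists_gradient [FiniteDimensional ℝ V] (hB : IsLorentzianOn B ⊤)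
    (l : V →L[ℝ] ℝ) :
    ∃ z, B z = l := by
  have hinj : Function.Injective B.toLinearMap := by
    rw [← LinearMap.ker_eq_bot, LinearMap.ker_eq_bot']
    intro z hz
    obtain ⟨T, -, hT, hpos⟩ := hB.2
    have hz' : ∀ v, B z v = 0 := fun v ↦ by
      have : B z = 0 := hz
      simp [this]
    by_contra hz0
    exact (hpos z trivial (by rw [hB.comm, hz']) hz0).ne' (hz' z)
  have hfr : Module.finrank ℝ V = Module.finrank ℝ (V →L[ℝ] ℝ) := by
    rw [← (LinearMap.toContinuousLinearMap (𝕜 := ℝ) (E := V) (F' := ℝ)).finrank_eq]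
    exact (Subspace.dual_finrank_eq (K := ℝ) (V := V)).symm
  exact (LinearMap.injective_iff_surjective_of_finrank_eq_finrank hfr).1 hinj l

/-- The left side is the value of `B` on the component of `u` orthogonal to `T`. -/
theorem IsLorentzianOn.add_sq_nonneg (hB : IsLorentzianOn B ⊤) {T : V} (hT : B T T < 0) (u : V) :
    0 ≤ B u u + (-(B T T))⁻¹ * B T u ^ 2 := by
  have h := hB.nonneg_of_orthogonal (u := u - (B T u / B T T) • T) hT
    (by simp [div_mul_cancel₀ _ hT.ne])
  simp only [map_sub, map_smul, smul_eq_mul, _root_.sub_apply,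
    _root_.smul_apply, hB.comm u T] at h
  convert h using 1
  have := hT.ne
  field_simp
  ring

/-- Reversing the sign of `B` on the line of a timelike vector `T` gives a positive definite form,
which dominates the norm. -/
theorem IsLorentzianOn.exists_norm_sq_le [FiniteDimensional ℝ V] (hB : IsLorentzianOn B ⊤)
    {T : V} (hT : B T T < 0) :
    ∃ m > 0, ∀ u, m * ‖u‖ ^ 2 ≤ B u u + 2 * (-(B T T))⁻¹ * B T u ^ 2 := by
  set κ := (-(B T T))⁻¹ with hκ
  have hκ0 : 0 < κ := inv_pos.2 (neg_pos.2 hT)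
  have hpos : ∀ u, u ≠ 0 → 0 < B u u + 2 * κ * B T u ^ 2 := by
    intro u hu
    by_cases h : B T u = 0
    · simpa [h] using hB.pos_of_orthogonal hT h hu
    · have h1 := hB.add_sq_nonneg hT u
      have h2 : 0 < κ * B T u ^ 2 := by positivity
      linarith
  have hcont : Continuous fun u ↦ B u u + 2 * κ * B T u ^ 2 := by fun_prop
  have hcpt : IsCompact (Metric.sphere (0 : V) 1) := isCompact_sphere 0 1
  have key : ∃ m > 0, ∀ u ∈ Metric.sphere (0 : V) 1, m ≤ B u u + 2 * κ * B T u ^ 2 := by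
    rcases (Metric.sphere (0 : V) 1).eq_empty_or_nonempty with he | hne
    · exact ⟨1, one_pos, by simp [he]⟩
    · obtain ⟨u, hu, hmin⟩ := hcpt.exists_isMinOn hne hcont.continuousOn
      exact ⟨_, hpos u (ne_zero_of_mem_unit_sphere ⟨u, hu⟩), fun v hv ↦ hmin hv⟩
  obtain ⟨m, hm, hmu⟩ := key
  refine ⟨m, hm, fun u ↦ ?_⟩
  rcases eq_or_ne u 0 with rfl | hu
  · simp
  · have hn : ‖u‖ ≠ 0 := norm_ne_zero_iff.2 hu
    have h := hmu (‖u‖⁻¹ • u) (by simp [norm_smul, hn])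
    simp only [map_smul, smul_eq_mul, _root_.smul_apply] at h
    calc m * ‖u‖ ^ 2 ≤ _ := mul_le_mul_of_nonneg_right h (sq_nonneg _)
      _ = _ := by field_simp

/-- Stability of the timelike cones under small perturbations `B'` of a Lorentzian scalar product
`B`: vectors that are timelike for one of the two, uniformly with respect to the size of `B T`, are
timelike for the other, and causal vectors for `B'` are not orthogonal to `T` for `B`. -/
theorem IsLorentzianOn.exists_stable [FiniteDimensional ℝ V] (hB : IsLorentzianOn B ⊤) {T : V}
    (hT : B T T < 0) {ν : ℝ} (hν : 0 < ν) :
    ∃ ε > 0, ∀ B' : V →L[ℝ] V →L[ℝ] ℝ, (∀ u, |B' u u - B u u| ≤ ε * ‖u‖ ^ 2) → ∀ u,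
      (u ≠ 0 → B' u u ≤ 0 → B T u ≠ 0) ∧
      (B' u u ≤ -ν * B T u ^ 2 → B u u ≤ -(ν / 2) * B T u ^ 2) ∧
      (B u u ≤ -(ν / 2) * B T u ^ 2 → B T u ≠ 0 → B' u u < 0) := by
  obtain ⟨m, hm, hmu⟩ := hB.exists_norm_sq_le hT
  set κ := (-(B T T))⁻¹ with hκ
  have hκ0 : 0 < κ := inv_pos.2 (neg_pos.2 hT)
  -- `m / 2` absorbs half of the norm estimate; `ν * m / (16 * κ)` makes the error `ε ‖u‖²` at most
  -- `ν / 4` times `(B T u)²` for the vectors in question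
  set ε := min (m / 2) (ν * m / (16 * κ)) with hε
  have hε0 : 0 < ε := by positivity
  have hε1 : ε ≤ m / 2 := min_le_left _ _
  have hε2 : ε * κ ≤ ν * m / 16 := by
    calc ε * κ ≤ ν * m / (16 * κ) * κ := by gcongr; exact min_le_right _ _
      _ = ν * m / 16 := by field_simp
  refine ⟨ε, hε0, fun B' hB' u ↦ ?_⟩
  have hclose := abs_le.1 (hB' u)
  have hmu := hmu u
  have hL : 0 ≤ B T u ^ 2 := sq_nonneg _
  -- the norm of a vector which is causal for `B'` is controlled by `B T`
  have hnorm : ∀ C, ‖u‖ ^ 2 * m ≤ C * κ * B T u ^ 2 → ε * ‖u‖ ^ 2 ≤ C * ν / 16 * B T u ^ 2 := by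
    intro C hC
    have hC0 : 0 ≤ C * B T u ^ 2 := by
      have : 0 ≤ C * B T u ^ 2 * κ := by
        calc 0 ≤ ‖u‖ ^ 2 * m := by positivity
          _ ≤ _ := hC
          _ = _ := by ring
      exact nonneg_of_mul_nonneg_left this hκ0
    refine le_of_mul_le_mul_right ?_ hm
    calc ε * ‖u‖ ^ 2 * m = ε * (‖u‖ ^ 2 * m) := by ring
      _ ≤ ε * (C * κ * B T u ^ 2) := by gcongr
      _ = ε * κ * (C * B T u ^ 2) := by ring
      _ ≤ ν * m / 16 * (C * B T u ^ 2) := by gcongr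
      _ = C * ν / 16 * B T u ^ 2 * m := by ring
  have hhalf : ε * ‖u‖ ^ 2 ≤ m / 2 * ‖u‖ ^ 2 := by gcongr
  refine ⟨fun hu hu' h0 ↦ ?_, fun h ↦ ?_, fun h h0 ↦ ?_⟩
  · rw [h0] at hmu
    have : 0 < m * ‖u‖ ^ 2 := by positivity
    linarith
  · have h1 := hnorm 4 (by nlinarith [mul_nonneg hν.le hL])
    nlinarith [mul_nonneg hν.le hL]
  · have hL' : 0 < ν * B T u ^ 2 := by positivity
    have h1 := hnorm 2 (by nlinarith)
    nlinarith

theorem eventually_abs_sub_le {X : Type*} [TopologicalSpace X] {G : X → V →L[ℝ] V →L[ℝ] ℝ} {x : X}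
    (hG : ContinuousAt G x) {ε : ℝ} (hε : 0 < ε) :
    ∀ᶠ p in nhds x, ∀ u, |G p u u - G x u u| ≤ ε * ‖u‖ ^ 2 := by
  filter_upwards [hG.eventually (Metric.ball_mem_nhds (G x) hε)] with p hp u
  have h : ‖(G p - G x) u u‖ ≤ _ := ContinuousLinearMap.le_opNorm₂ _ u u
  rw [Real.norm_eq_abs, mul_assoc, ← sq] at h
  have hp' : ‖G p - G x‖ ≤ ε := (dist_eq_norm (G p) (G x)).symm.trans_le (le_of_lt hp)
  exact h.trans (by gcongr)

end LorentzNormed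

/-! ### Absolutely continuous functions -/

section AbsolutelyContinuous

theorem _root_.AbsolutelyContinuousOnInterval.clm_comp {E F : Type*} [NormedAddCommGroup E]
    [NormedSpace ℝ E] [NormedAddCommGroup F] [NormedSpace ℝ F] {f : ℝ → E} {a b : ℝ}
    (hf : AbsolutelyContinuousOnInterval f a b) (L : E →L[ℝ] F) :
    AbsolutelyContinuousOnInterval (fun t ↦ L (f t)) a b := by
  unfold AbsolutelyContinuousOnInterval at hf ⊢
  have h := hf.const_mul ‖L‖
  rw [mul_zero] at h
  refine squeeze_zero (fun _ ↦ Finset.sum_nonneg fun _ _ ↦ dist_nonneg) (fun E ↦ ?_) h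
  rw [Finset.mul_sum]
  exact Finset.sum_le_sum fun i _ ↦ L.dist_le_opNorm _ _

theorem _root_.AbsolutelyContinuousOnInterval.le_of_ae_hasDerivAt_nonneg {f : ℝ → ℝ} {c d : ℝ}
    (hcd : c ≤ d) (hf : AbsolutelyContinuousOnInterval f c d)
    (h : ∀ᵐ t ∂(volume.restrict (Icc c d)), ∃ u, HasDerivAt f u t ∧ 0 ≤ u) : f c ≤ f d := by
  rw [← sub_nonneg, ← hf.integral_deriv_eq_sub]
  refine intervalIntegral.integral_nonneg_of_ae_restrict hcd ?_
  filter_upwards [h] with t ⟨u, hu, hu0⟩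
  simpa [hu.deriv] using hu0

theorem _root_.AbsolutelyContinuousOnInterval.lt_of_ae_hasDerivAt_pos {f : ℝ → ℝ} {c d : ℝ}
    (hcd : c < d) (hf : AbsolutelyContinuousOnInterval f c d)
    (h : ∀ᵐ t ∂(volume.restrict (Icc c d)), ∃ u, HasDerivAt f u t ∧ 0 < u) : f c < f d := by
  rw [← sub_pos, ← hf.integral_deriv_eq_sub]
  have h' : ∀ᵐ t ∂(volume.restrict (Ioc c d)), 0 < deriv f t := by
    refine ae_restrict_of_ae_restrict_of_subset Ioc_subset_Icc_self ?_
    filter_upwards [h] with t ⟨u, hu, hu0⟩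
    simpa [hu.deriv] using hu0
  rw [intervalIntegral.integral_pos_iff_support_of_nonneg_ae' _ hf.intervalIntegrable_deriv]
  · refine ⟨hcd, ?_⟩
    rw [← Measure.restrict_apply' measurableSet_Ioc]
    have : (volume.restrict (Ioc c d)) (Function.support (deriv f)) =
        (volume.restrict (Ioc c d)) univ := by
      refine measure_congr ?_
      filter_upwards [h'] with t ht
      exact eq_true (p := t ∈ Function.support (deriv f)) ht.ne' |>.trans (eq_true (mem_univ t)).symm
    rw [this]
    simpa using hcd
  · rw [uIoc_of_le hcd.le]
    filter_upwards [h'] with t ht using ht.le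

/-- If almost every velocity of an absolutely continuous curve lies in the closed convex cone
`{u | 0 ≤ -B T u, B u u ≤ -ν (B T u)²}` (for a timelike `T`), then so does its displacement. -/
theorem IsLorentzianOn.displacement_timelike {V : Type*} [NormedAddCommGroup V] [NormedSpace ℝ V]
    {B : V →L[ℝ] V →L[ℝ] ℝ} (hB : IsLorentzianOn B ⊤) {T : V} (hT : B T T < 0)
    {f : ℝ → V} {c d ν : ℝ} (hcd : c < d)
    (hf : AbsolutelyContinuousOnInterval f c d)
    (h : ∀ᵐ t ∂(volume.restrict (Icc c d)),
      ∃ u, HasDerivAt f u t ∧ B T u < 0 ∧ B u u ≤ -ν * B T u ^ 2) :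
    B T (f d - f c) < 0 ∧ B (f d - f c) (f d - f c) ≤ -ν * B T (f d - f c) ^ 2 := by
  set κ := (-(B T T))⁻¹ with hκ
  set w := f d - f c with hw
  have hlt : B T w < 0 := by
    have h1 := (hf.clm_comp (-(B T))).lt_of_ae_hasDerivAt_pos hcd (by
      filter_upwards [h] with t ⟨u, hu, hu0, _⟩
      exact ⟨_, (-(B T)).hasFDerivAt.comp_hasDerivAt t hu, by simpa using hu0⟩)
    simp only [_root_.neg_apply] at h1
    rw [hw, map_sub]
    linarith
  refine ⟨hlt, ?_⟩
  -- the semidefinite form `H = B + κ (B T) ⊗ (B T)` and its Cauchy-Schwarz inequality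
  let H : V →L[ℝ] V →L[ℝ] ℝ := B + κ • (B T).smulRight (B T)
  have hH : ∀ x y, H x y = B x y + κ * (B T x * B T y) := fun x y ↦ by simp [H]
  have hH0 : ∀ x, 0 ≤ H x x := fun x ↦ by
    rw [hH, ← sq]; exact hB.add_sq_nonneg hT x
  have hCS : ∀ x y, H x y ^ 2 ≤ H x x * H y y := by
    intro x y
    have hq : ∀ s : ℝ, 0 ≤ H y y * (s * s) + (2 * H x y) * s + H x x := by
      intro s
      have h1 := hH0 (x + s • y)
      simp only [hH, map_add, map_smul, _root_.add_apply, smul_eq_mul,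
        _root_.smul_apply, hB.comm y x] at h1 ⊢
      linarith
    have := discrim_le_zero hq
    rw [discrim] at this
    linarith
  have hcone : ∀ {u}, B u u ≤ -ν * B T u ^ 2 → H u u ≤ (κ - ν) * B T u ^ 2 := by
    intro u hu
    rw [hH]; linarith
  have hβ : 0 ≤ κ - ν := by
    have : (ae (volume.restrict (Icc c d))).NeBot := by
      rw [ae_neBot, Ne, Measure.restrict_eq_zero]
      simpa using hcd
    obtain ⟨t, u, -, hu0, hu⟩ := h.exists
    have h2 : 0 < B T u ^ 2 := sq_pos_of_neg hu0
    exact nonneg_of_mul_nonneg_left ((hH0 u).trans (hcone hu)) h2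
  set S := √(H w w * (κ - ν)) with hS
  have hbound : H w w ≤ S * -(B T w) := by
    have h1 := (hf.clm_comp (S • -(B T) - H w)).le_of_ae_hasDerivAt_nonneg hcd.le (by
      filter_upwards [h] with t ⟨u, hu, hu0, hu1⟩
      refine ⟨_, (S • -(B T) - H w).hasFDerivAt.comp_hasDerivAt t hu, ?_⟩
      have h2 : H w u ≤ S * -(B T u) := by
        refine le_of_sq_le_sq ?_ (mul_nonneg (Real.sqrt_nonneg _) (by linarith))
        rw [mul_pow, hS, Real.sq_sqrt (mul_nonneg (hH0 w) hβ), mul_assoc, neg_sq]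
        exact (hCS w u).trans (mul_le_mul_of_nonneg_left (hcone hu1) (hH0 w))
      simpa using h2)
    have h3 : (S • -(B T) - H w) w = (S • -(B T) - H w) (f d) - (S • -(B T) - H w) (f c) := by
      rw [hw, map_sub]
    have h4 : 0 ≤ (S • -(B T) - H w) w := by rw [h3]; linarith
    simpa using h4
  have hfin : H w w ≤ (κ - ν) * B T w ^ 2 := by
    rcases (hH0 w).eq_or_lt with h0 | h0
    · rw [← h0]; positivity
    · have h1 : H w w ^ 2 ≤ (S * -(B T w)) ^ 2 := by gcongr
      rw [mul_pow, hS, Real.sq_sqrt (mul_nonneg (hH0 w) hβ), neg_sq] at h1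
      refine le_of_mul_le_mul_left ?_ h0
      linarith
  rw [hH] at hfin
  linarith

/-- An injective function whose derivative is nonzero almost everywhere takes values in a given null
set only on a null set, by the change of variables formula. -/
theorem ae_comp_of_injOn {f : ℝ → ℝ} {s t : Set ℝ} (hs : MeasurableSet s) (ht : MeasurableSet t)
    (hcont : ContinuousOn f s) (hinj : InjOn f s) (hmaps : MapsTo f s t)
    (hd : ∀ᵐ x ∂(volume.restrict s), deriv f x ≠ 0) {P : ℝ → Prop}
    (hP : ∀ᵐ y ∂(volume.restrict t), P y) : ∀ᵐ x ∂(volume.restrict s), P (f x) := by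
  rw [ae_restrict_iff' ht] at hP
  rw [ae_restrict_iff' hs] at hd ⊢
  set Z := toMeasurable volume {y | ¬(y ∈ t → P y)} with hZ
  have hZ0 : volume Z = 0 := (measure_toMeasurable _).trans hP
  have hpre : MeasurableSet (s ∩ f ⁻¹' Z) := by
    have h1 := hs.subtype_image
      (hcont.domRestrict.measurable (measurableSet_toMeasurable volume {y | ¬(y ∈ t → P y)}))
    convert h1 using 1
    ext x
    simp [hZ, and_comm]
  set S := s ∩ f ⁻¹' Z ∩ {x | deriv f x ≠ 0} with hS
  have hSm : MeasurableSet S :=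
    hpre.inter ((measurable_deriv f) (measurableSet_singleton 0).compl)
  have hSs : S ⊆ s := fun x hx ↦ hx.1.1
  have hcov := lintegral_image_eq_lintegral_abs_deriv_mul hSm
    (fun x hx ↦ (differentiableAt_of_deriv_ne_zero hx.2).hasDerivAt.hasDerivWithinAt)
    (hinj.mono hSs) 1
  have hSZ : volume (f '' S) = 0 :=
    measure_mono_null (image_subset_iff.2 fun x hx ↦ hx.1.2) hZ0
  simp only [Pi.one_apply, mul_one, lintegral_one, Measure.restrict_apply_univ, hSZ] at hcov
  have hS0 : volume S = 0 := by
    have h1 := (lintegral_eq_zero_iff (by fun_prop)).1 hcov.symm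
    rw [Filter.EventuallyEq, ae_restrict_iff' hSm] at h1
    refine measure_mono_null (fun x hx ↦ ?_) h1
    simpa [hx] using hx.2
  have hS0' : ∀ᵐ x, x ∉ S := measure_eq_zero_iff_ae_notMem.1 hS0
  filter_upwards [hd, hS0'] with x hx hxS hxs
  by_contra hPx
  exact hxS ⟨⟨hxs, subset_toMeasurable _ _ fun h ↦ hPx (h (hmaps hxs))⟩, hx hxs⟩

end AbsolutelyContinuous

open Bundle Topology Filter

variable {n : ℕ} [NeZero n] {M : Type*} [TopologicalSpace M]
  [ChartedSpace (EuclideanHalfSpace n) M] [IsManifold (𝓡∂ n) 1 M] {g : LorentzMetric n M}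

/-! ### Future cones and temporal functions -/

/-- The differential of a real function, as a covector. -/
noncomputable def differential (τ : M → ℝ) (p : M) : TangentSpace (𝓡∂ n) p →L[ℝ] ℝ :=
  mfderiv (𝓡∂ n) 𝓘(ℝ, ℝ) τ p

namespace TimeOrientation

variable (o : TimeOrientation g) {p : M}

theorem timelike_of_mem_cone {v : TangentSpace (𝓡∂ n) p} (hv : v ∈ o.cone p) :
    g.val p v v < 0 := by
  obtain ⟨U, -, hp, X, -, hX⟩ := o.continuously_chosen p
  rw [(hX p hp).2] at hv
  exact hv.1

theorem neg_of_mem_cone {u v : TangentSpace (𝓡∂ n) p} (hu : u ∈ o.cone p) (hv : v ∈ o.cone p) :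
    g.val p u v < 0 := by
  obtain ⟨U, -, hp, X, -, hX⟩ := o.continuously_chosen p
  rw [(hX p hp).2] at hu hv
  exact (g.lorentzian p).neg_of_same_cone (hX p hp).1 hu.1 hu.2 hv.1.le hv.2

theorem mem_cone_of_neg {u v : TangentSpace (𝓡∂ n) p} (hu : u ∈ o.cone p)
    (hv : g.val p v v < 0) (huv : g.val p u v < 0) : v ∈ o.cone p := by
  obtain ⟨U, -, hp, X, -, hX⟩ := o.continuously_chosen p
  have hu' := hu
  rw [(hX p hp).2] at hu' ⊢
  refine ⟨hv, (g.lorentzian p).neg_of_same_cone hu'.1 (hX p hp).1 ?_ hv.le huv⟩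
  rw [(g.lorentzian p).comm]
  exact hu'.2

theorem smul_mem_cone {v : TangentSpace (𝓡∂ n) p} (hv : v ∈ o.cone p) {s : ℝ} (hs : 0 < s) :
    s • v ∈ o.cone p := by
  have h := o.timelike_of_mem_cone hv
  refine o.mem_cone_of_neg hv ?_ ?_ <;>
    simp only [map_smul, _root_.smul_apply, smul_eq_mul]
  · exact mul_neg_of_pos_of_neg hs (mul_neg_of_pos_of_neg hs h)
  · exact mul_neg_of_pos_of_neg hs h

theorem futureCausal_of_mem_cone {v : TangentSpace (𝓡∂ n) p} (hv : v ∈ o.cone p) :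
    o.FutureCausal v := by
  have h := o.timelike_of_mem_cone hv
  refine ⟨?_, h.le, fun w hw ↦ o.neg_of_mem_cone hw hv⟩
  rintro rfl
  simp at h

variable {o}

theorem IsTemporalOn.differential_pos {r : ℕ∞} {τ : M → ℝ} {U : Set M}
    (hτ : o.IsTemporalOn r τ U) (hp : p ∈ U) {v : TangentSpace (𝓡∂ n) p} (hv : o.FutureCausal v) :
    0 < differential τ p v := by
  obtain ⟨w, hw, hwc⟩ := hτ.2.2 p hp
  have h := hv.2.2 _ hwc
  have hw' : g.val p w v = differential τ p v := hw v
  rwa [map_neg, _root_.neg_apply, hw', neg_lt_zero] at h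

end TimeOrientation

/-! ### The metric in the chart around a point -/

noncomputable section

variable (n) in
/-- The tangent vector at `p` with given components in the preferred chart around `x₀`. -/
def chartVector (x₀ p : M) : EuclideanSpace ℝ (Fin n) →L[ℝ] TangentSpace (𝓡∂ n) p :=
  (trivializationAt (EuclideanSpace ℝ (Fin n)) (TangentSpace (𝓡∂ n)) x₀).symmL ℝ p

variable (n) in
/-- The components of a tangent vector at `p` in the preferred chart around `x₀`. -/
def chartComponents (x₀ p : M) : TangentSpace (𝓡∂ n) p →L[ℝ] EuclideanSpace ℝ (Fin n) :=
  mfderiv (𝓡∂ n) 𝓘(ℝ, EuclideanSpace ℝ (Fin n)) (extChartAt (𝓡∂ n) x₀) p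

/-- The components of the metric at `p` in the preferred chart around `x₀`, as a bilinear form on
the model space. -/
def chartMetric (g : LorentzMetric n M) (x₀ p : M) :
    EuclideanSpace ℝ (Fin n) →L[ℝ] EuclideanSpace ℝ (Fin n) →L[ℝ] ℝ :=
  ContinuousLinearMap.inCoordinates (EuclideanSpace ℝ (Fin n)) (TangentSpace (𝓡∂ n))
    (EuclideanSpace ℝ (Fin n) →L[ℝ] ℝ) (fun x : M ↦ TangentSpace (𝓡∂ n) x →L[ℝ] ℝ)
    x₀ p x₀ p (g.val p)

theorem continuousAt_chartMetric (g : LorentzMetric n M) (x₀ : M) :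
    ContinuousAt (chartMetric g x₀) x₀ := by
  have h := g.contMDiff.continuous.continuousAt (x := x₀)
  simp only [continuousAt_hom_bundle] at h
  exact h.2

variable {x₀ p : M}

theorem chartMetric_apply (hp : p ∈ (chartAt (EuclideanHalfSpace n) x₀).source)
    (u v : EuclideanSpace ℝ (Fin n)) :
    chartMetric g x₀ p u v = g.val p (chartVector n x₀ p u) (chartVector n x₀ p v) := by
  have hp' : p ∈ (trivializationAt (EuclideanSpace ℝ (Fin n))
    (TangentSpace (𝓡∂ n) (M := M)) x₀).baseSet := by simpa using hp
  unfold chartMetric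
  rw [inCoordinates_apply_eq₂ hp' hp' (Set.mem_univ _)]
  simp only [chartVector, Trivialization.symmL_apply _ hp']
  simp

theorem chartVector_eq_mfderivWithin (hp : p ∈ (chartAt (EuclideanHalfSpace n) x₀).source) :
    chartVector n x₀ p = mfderivWithin 𝓘(ℝ, EuclideanSpace ℝ (Fin n)) (𝓡∂ n)
      (extChartAt (𝓡∂ n) x₀).symm (range (𝓡∂ n)) (extChartAt (𝓡∂ n) x₀ p) :=
  TangentBundle.symmL_trivializationAt hp

theorem chartComponents_eq (hp : p ∈ (chartAt (EuclideanHalfSpace n) x₀).source) :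
    chartComponents n x₀ p = (trivializationAt (EuclideanSpace ℝ (Fin n))
      (TangentSpace (𝓡∂ n)) x₀).continuousLinearMapAt ℝ p :=
  (TangentBundle.continuousLinearMapAt_trivializationAt hp).symm

theorem chartComponents_chartVector (hp : p ∈ (chartAt (EuclideanHalfSpace n) x₀).source)
    (u : EuclideanSpace ℝ (Fin n)) : chartComponents n x₀ p (chartVector n x₀ p u) = u := by
  rw [chartComponents_eq hp]
  exact Trivialization.continuousLinearMapAt_symmL _ (by simpa using hp) u

theorem chartVector_chartComponents (hp : p ∈ (chartAt (EuclideanHalfSpace n) x₀).source)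
    (v : TangentSpace (𝓡∂ n) p) : chartVector n x₀ p (chartComponents n x₀ p v) = v := by
  rw [chartComponents_eq hp]
  exact Trivialization.symmL_continuousLinearMapAt _ (by simpa using hp) v

theorem isLorentzianOn_chartMetric (g : LorentzMetric n M)
    (hp : p ∈ (chartAt (EuclideanHalfSpace n) x₀).source) :
    IsLorentzianOn (chartMetric g x₀ p) ⊤ := by
  have h := g.lorentzian p
  refine ⟨fun v _ w _ ↦ ?_, ?_⟩
  · rw [chartMetric_apply hp, chartMetric_apply hp, h.comm]
  obtain ⟨T, -, hT, hpos⟩ := h.2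
  refine ⟨chartComponents n x₀ p T, trivial, ?_, fun v _ hv hv0 ↦ ?_⟩
  · rw [chartMetric_apply hp, chartVector_chartComponents hp]
    exact hT
  · rw [chartMetric_apply hp, chartVector_chartComponents hp] at hv
    rw [chartMetric_apply hp]
    refine hpos _ trivial hv fun h0 ↦ hv0 ?_
    rw [← chartComponents_chartVector hp v, h0, map_zero]

/-- Every point `x₀` has vector components `T` which are future-directed timelike at all
points near `x₀`. -/
theorem TimeOrientation.exists_chartVector_mem_cone (o : TimeOrientation g) (x₀ : M) :
    ∃ T : EuclideanSpace ℝ (Fin n), ∀ᶠ p in 𝓝 x₀, chartVector n x₀ p T ∈ o.cone p := by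
  obtain ⟨U, hUo, hx₀, X, hXc, hX⟩ := o.continuously_chosen x₀
  have hsrc : x₀ ∈ (chartAt (EuclideanHalfSpace n) x₀).source := mem_chart_source _ x₀
  let T : EuclideanSpace ℝ (Fin n) := chartComponents n x₀ x₀ (X x₀)
  have hT : chartVector n x₀ x₀ T = X x₀ := chartVector_chartComponents hsrc _
  have hYc : ContinuousAt (fun q ↦ chartComponents n x₀ q (X q)) x₀ := by
    have h := hXc.continuousAt (hUo.mem_nhds hx₀)
    rw [FiberBundle.continuousAt_totalSpace] at h
    refine h.2.congr ?_
    filter_upwards [(chartAt (EuclideanHalfSpace n) x₀).open_source.mem_nhds hsrc] with q hq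
    rw [chartComponents_eq hq]
    exact (Trivialization.continuousLinearMapAt_apply_of_mem ℝ _ (by simpa using hq) _).symm
  have hG := continuousAt_chartMetric g x₀
  have hneg : chartMetric g x₀ x₀ T T < 0 := by
    rw [chartMetric_apply hsrc, hT]
    exact (hX x₀ hx₀).1
  have h1 : ∀ᶠ p in 𝓝 x₀, chartMetric g x₀ p T T < 0 :=
    (ContinuousAt.clm_apply (hG.clm_apply continuousAt_const) continuousAt_const).eventually_lt
      continuousAt_const hneg
  have h2 : ∀ᶠ p in 𝓝 x₀, chartMetric g x₀ p (chartComponents n x₀ p (X p)) T < 0 :=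
    (ContinuousAt.clm_apply (hG.clm_apply hYc) continuousAt_const).eventually_lt
      continuousAt_const hneg
  refine ⟨T, ?_⟩
  filter_upwards [h1, h2, hUo.mem_nhds hx₀,
    (chartAt (EuclideanHalfSpace n) x₀).open_source.mem_nhds hsrc] with p hp1 hp2 hpU hps
  rw [(hX p hpU).2]
  rw [chartMetric_apply hps] at hp1 hp2
  rw [chartVector_chartComponents hps] at hp2
  exact ⟨hp1, hp2⟩

end

variable {o : TimeOrientation g} {r : ℕ∞}

/-! ### Velocities of curves -/

omit [IsManifold (𝓡∂ n) 1 M] in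
theorem exists_velocity_congr {α β : ℝ → M} {s : Set ℝ} {t : ℝ} (h : EqOn β α s) (ht : t ∈ s)
    {P : ∀ p : M, TangentSpace (𝓡∂ n) p → Prop}
    (hα : ∃ v : TangentSpace (𝓡∂ n) (α t), HasVelocityWithinAt α s t v ∧ P (α t) v) :
    ∃ v : TangentSpace (𝓡∂ n) (β t), HasVelocityWithinAt β s t v ∧ P (β t) v := by
  obtain ⟨v, hv, hP⟩ := hα
  unfold HasVelocityWithinAt at hv ⊢
  exact ⟨(v : EuclideanSpace ℝ (Fin n)), hv.congr_mono h (h ht) Subset.rfl, (h ht).symm ▸ hP⟩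

theorem HasVelocityWithinAt.hasDerivWithinAt_chart {γ : ℝ → M} {s : Set ℝ} {t : ℝ}
    {v : TangentSpace (𝓡∂ n) (γ t)} (h : HasVelocityWithinAt γ s t v) {x₀ : M}
    (hsrc : γ t ∈ (chartAt (EuclideanHalfSpace n) x₀).source) :
    HasDerivWithinAt (fun t ↦ extChartAt (𝓡∂ n) x₀ (γ t)) (chartComponents n x₀ (γ t) v) s t := by
  have h1 := (mdifferentiableAt_extChartAt (I := 𝓡∂ n) hsrc).hasMFDerivAt
  have h2 : HasFDerivWithinAt (fun t ↦ extChartAt (𝓡∂ n) x₀ (γ t))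
      ((chartComponents n x₀ (γ t)).comp ((1 : ℝ →L[ℝ] ℝ).smulRight v)) s t :=
    hasMFDerivWithinAt_iff_hasFDerivWithinAt.1 (HasMFDerivAt.comp_hasMFDerivWithinAt t h1 h)
  refine h2.hasDerivWithinAt.congr_deriv ?_
  change chartComponents n x₀ (γ t) ((1 : ℝ) • v) = _
  rw [one_smul]

omit [IsManifold (𝓡∂ n) 1 M] in
theorem HasVelocityWithinAt.hasDerivWithinAt_comp {γ : ℝ → M} {s : Set ℝ} {t : ℝ}
    {v : TangentSpace (𝓡∂ n) (γ t)} (h : HasVelocityWithinAt γ s t v) {τ : M → ℝ}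
    (hτ : MDifferentiableAt (𝓡∂ n) 𝓘(ℝ, ℝ) τ (γ t)) :
    HasDerivWithinAt (fun t ↦ τ (γ t)) (differential τ (γ t) v) s t := by
  have h2 : HasFDerivWithinAt (fun t ↦ τ (γ t))
      ((differential τ (γ t)).comp ((1 : ℝ →L[ℝ] ℝ).smulRight v)) s t :=
    hasMFDerivWithinAt_iff_hasFDerivWithinAt.1
      (HasMFDerivAt.comp_hasMFDerivWithinAt t hτ.hasMFDerivAt h)
  refine h2.hasDerivWithinAt.congr_deriv ?_
  change differential τ (γ t) ((1 : ℝ) • v) = _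
  rw [one_smul]

theorem differential_comp_extChartAt {x₀ p : M}
    (hp : p ∈ (chartAt (EuclideanHalfSpace n) x₀).source) (l : EuclideanSpace ℝ (Fin n) →L[ℝ] ℝ)
    (v : TangentSpace (𝓡∂ n) p) :
    differential (fun q ↦ l (extChartAt (𝓡∂ n) x₀ q)) p v = l (chartComponents n x₀ p v) := by
  have h1 := (mdifferentiableAt_extChartAt (I := 𝓡∂ n) hp).hasMFDerivAt
  have h2 : HasMFDerivAt 𝓘(ℝ, EuclideanSpace ℝ (Fin n)) 𝓘(ℝ, ℝ) l (extChartAt (𝓡∂ n) x₀ p) l :=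
    l.hasFDerivAt.hasMFDerivAt
  have h3 := (h2.comp p h1).mfderiv
  exact congrArg (fun L : EuclideanSpace ℝ (Fin n) →L[ℝ] ℝ ↦ L v) h3

/-! ### Concatenation of piecewise smooth curves and straight segments -/

theorem TimeOrientation.IsPiecewiseSmoothTimelike.concat {α β : ℝ → M} {a m b : ℝ}
    (hα : o.IsPiecewiseSmoothTimelike r α a m) (hβ : o.IsPiecewiseSmoothTimelike r β m b)
    (hm : α m = β m) :
    o.IsPiecewiseSmoothTimelike r (fun t ↦ if t ≤ m then α t else β t) a b := by
  obtain ⟨k, t, ht0, htk, ht⟩ := hα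
  obtain ⟨l, s, hs0, hsl, hs⟩ := hβ
  have htm : ∀ i ≤ k, t i ≤ m := by
    intro i hi
    induction hi using Nat.decreasingInduction with
    | self => exact htk.le
    | of_succ i hi ih => exact (ht i hi).1.le.trans ih
  have hsm : ∀ i ≤ l, m ≤ s i := by
    intro i hi
    induction i with
    | zero => exact hs0.ge
    | succ i ih => exact (ih (by omega)).trans (hs i (by omega)).1.le
  refine ⟨k + l, fun i ↦ if i ≤ k then t i else s (i - k), by simp [ht0], ?_, fun i hi ↦ ?_⟩
  · rcases Nat.eq_zero_or_pos l with rfl | hl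
    · simp only [add_zero, le_refl, if_true, htk, ← hsl, hs0]
    · simp [hl.ne', hsl]
  rcases Nat.lt_or_ge i k with hik | hik
  · simp only [hik.le, Nat.succ_le_of_lt hik, if_true]
    have heq : EqOn (fun t ↦ if t ≤ m then α t else β t) α (Icc (t i) (t (i + 1))) :=
      fun x hx ↦ if_pos (hx.2.trans (htm _ hik))
    obtain ⟨h1, h2, h3⟩ := ht i hik
    exact ⟨h1, h2.congr heq, fun x hx ↦
      exists_velocity_congr (P := fun p v ↦ v ∈ o.cone p) heq hx (h3 x hx)⟩
  · obtain ⟨j, rfl⟩ := Nat.exists_eq_add_of_le hik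
    have hj : j < l := by omega
    have e1 : (if k + j ≤ k then t (k + j) else s (k + j - k)) = s j := by
      rcases Nat.eq_zero_or_pos j with rfl | hj0
      · simp [htk, hs0]
      · rw [if_neg (by omega), Nat.add_sub_cancel_left]
    have e2 : (if k + j + 1 ≤ k then t (k + j + 1) else s (k + j + 1 - k)) = s (j + 1) := by
      rw [if_neg (by omega), add_assoc, Nat.add_sub_cancel_left]
    simp only [e1, e2]
    have heq : EqOn (fun t ↦ if t ≤ m then α t else β t) β (Icc (s j) (s (j + 1))) := by
      intro x hx
      rcases (hsm j hj.le |>.trans hx.1).eq_or_lt with h | h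
      · simp [← h, hm]
      · exact if_neg (not_le.2 h)
    obtain ⟨h1, h2, h3⟩ := hs j hj
    exact ⟨h1, h2.congr heq, fun x hx ↦
      exists_velocity_congr (P := fun p v ↦ v ∈ o.cone p) heq hx (h3 x hx)⟩

theorem TimeOrientation.isPiecewiseSmoothTimelike_segment [IsManifold (𝓡∂ n) r M] {x₀ : M}
    {y w : EuclideanSpace ℝ (Fin n)} {c d : ℝ} (hcd : c < d)
    (htgt : ∀ t ∈ Icc c d, y + (t - c) • w ∈ (extChartAt (𝓡∂ n) x₀).target)
    (hcone : ∀ t ∈ Icc c d, chartVector n x₀ ((extChartAt (𝓡∂ n) x₀).symm (y + (t - c) • w)) w ∈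
      o.cone ((extChartAt (𝓡∂ n) x₀).symm (y + (t - c) • w))) :
    o.IsPiecewiseSmoothTimelike r (fun t ↦ (extChartAt (𝓡∂ n) x₀).symm (y + (t - c) • w)) c d := by
  refine ⟨1, fun i ↦ if i = 0 then c else d, by simp, by simp, fun i hi ↦ ?_⟩
  obtain rfl : i = 0 := by omega
  simp only [if_true, zero_add, one_ne_zero, if_false]
  have hmaps : MapsTo (fun t : ℝ ↦ y + (t - c) • w) (Icc c d) (extChartAt (𝓡∂ n) x₀).target := htgt
  refine ⟨hcd, ?_, fun t ht ↦ ⟨_, ?_, hcone t ht⟩⟩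
  · refine (contMDiffOn_extChartAt_symm (I := 𝓡∂ n) (n := r) x₀).comp ?_ hmaps
    apply ContMDiff.contMDiffOn
    apply ContDiff.contMDiff
    fun_prop
  · have h1 := (mdifferentiableWithinAt_extChartAt_symm (I := 𝓡∂ n) (hmaps ht)).hasMFDerivWithinAt
    have h2 : HasDerivWithinAt (fun t : ℝ ↦ y + (t - c) • w) w (Icc c d) t := by
      have := (((hasDerivAt_id t).sub_const c).smul_const w).const_add y
      simpa using this.hasDerivWithinAt
    have h3 := HasMFDerivWithinAt.comp t h1 h2.hasFDerivWithinAt.hasMFDerivWithinAt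
      (show Icc c d ⊆ (fun t : ℝ ↦ y + (t - c) • w) ⁻¹' range (𝓡∂ n) from
        fun s hs ↦ extChartAt_target_subset_range (I := 𝓡∂ n) x₀ (hmaps hs))
    have hsrc : (extChartAt (𝓡∂ n) x₀).symm (y + (t - c) • w) ∈
        (chartAt (EuclideanHalfSpace n) x₀).source := by
      simpa using (extChartAt (𝓡∂ n) x₀).map_target (hmaps ht)
    refine HasMFDerivWithinAt.congr_mfderiv h3 ?_
    ext
    rw [chartVector_eq_mfderivWithin hsrc, (extChartAt (𝓡∂ n) x₀).right_inv (hmaps ht)]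
    exact ContinuousLinearMap.map_smul _ (1 : ℝ) w

/-! ### Timelike displacement in a chart -/

variable (o r) in
/-- Near every point some linear function of the chart coordinates is a temporal function. -/
theorem TimeOrientation.exists_isTemporalOn_linear [IsManifold (𝓡∂ n) r M] (x₀ : M) :
    ∃ (T : EuclideanSpace ℝ (Fin n)) (U : Set M), chartMetric g x₀ x₀ T T < 0 ∧ x₀ ∈ U ∧
      U ⊆ (chartAt (EuclideanHalfSpace n) x₀).source ∧
      o.IsTemporalOn r (fun p ↦ -(chartMetric g x₀ x₀ T) (extChartAt (𝓡∂ n) x₀ p)) U := by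
  obtain ⟨T, hT⟩ := o.exists_chartVector_mem_cone x₀
  have hsrc : x₀ ∈ (chartAt (EuclideanHalfSpace n) x₀).source := mem_chart_source _ x₀
  have hTT : chartMetric g x₀ x₀ T T < 0 := by
    rw [chartMetric_apply hsrc]
    exact o.timelike_of_mem_cone hT.self_of_nhds
  obtain ⟨ε, hε, hstable⟩ := (isLorentzianOn_chartMetric g hsrc).exists_stable hTT one_pos
  have hG := eventually_abs_sub_le (continuousAt_chartMetric g x₀) hε
  obtain ⟨U, hU, hUo, hx₀⟩ := eventually_nhds_iff.1 (hT.and (hG.and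
    ((chartAt (EuclideanHalfSpace n) x₀).open_source.mem_nhds hsrc)))
  refine ⟨T, U, hTT, hx₀, fun p hp ↦ (hU p hp).2.2, hUo, ?_, fun p hp ↦ ?_⟩
  · have h1 : ContMDiff 𝓘(ℝ, EuclideanSpace ℝ (Fin n)) 𝓘(ℝ, ℝ) r
        (fun x ↦ -(chartMetric g x₀ x₀ T) x) :=
      ContDiff.contMDiff (by fun_prop)
    exact h1.comp_contMDiffOn ((contMDiffOn_extChartAt (I := 𝓡∂ n) (n := r) (x := x₀)).mono
      fun p hp ↦ (hU p hp).2.2)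
  · obtain ⟨hTp, hGp, hps⟩ := hU p hp
    obtain ⟨z, hz⟩ := (isLorentzianOn_chartMetric g hps).exists_gradient (chartMetric g x₀ x₀ T)
    have hz' : ∀ v : TangentSpace (𝓡∂ n) p, g.val p (chartVector n x₀ p z) v =
        chartMetric g x₀ x₀ T (chartComponents n x₀ p v) := by
      intro v
      rw [← hz, chartMetric_apply hps, chartVector_chartComponents hps]
    refine ⟨-chartVector n x₀ p z, fun v ↦ ?_, ?_⟩
    · change _ = differential (fun p ↦ (-(chartMetric g x₀ x₀ T)) (extChartAt (𝓡∂ n) x₀ p)) p v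
      rw [differential_comp_extChartAt hps]
      simp [hz']
    · rw [neg_neg]
      refine o.mem_cone_of_neg hTp ?_ ?_
      · rw [← chartMetric_apply hps]
        refine (isLorentzianOn_chartMetric g hps).timelike_of_kernel fun u hu0 hu hzu ↦ ?_
        rw [hz] at hzu
        exact (hstable _ hGp u).1 hu0 hu hzu
      · rw [(g.lorentzian p).comm, hz', chartComponents_chartVector hps]
        exact hTT

/-- Along an `H¹`-timelike curve in the domain `U` of a temporal function that is linear in a
chart, the coordinate velocity satisfies almost everywhere the scale invariant form of the
inequality required of the reparametrization. -/
theorem TimeOrientation.IsUniformlyTimelike.exists_chart_velocity_bound [IsManifold (𝓡∂ n) r M]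
    {γ : ℝ → M} {a b c d : ℝ} (hγ : o.IsFutureH1Causal r γ a b)
    (hu : o.IsUniformlyTimelike r γ a b) (hac : a ≤ c) (hcd : c < d) (hdb : d ≤ b)
    {x₀ : M} {U : Set M} (hUs : U ⊆ (chartAt (EuclideanHalfSpace n) x₀).source)
    (hγU : MapsTo γ (Icc c d) U) {l : EuclideanSpace ℝ (Fin n) →L[ℝ] ℝ}
    (hτ : o.IsTemporalOn r (fun p ↦ l (extChartAt (𝓡∂ n) x₀ p)) U) :
    AbsolutelyContinuousOnInterval (fun t ↦ extChartAt (𝓡∂ n) x₀ (γ t)) c d ∧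
      ∃ ν > 0, ∀ᵐ t ∂(volume.restrict (Icc c d)), ∃ u,
        HasDerivAt (fun t ↦ extChartAt (𝓡∂ n) x₀ (γ t)) u t ∧ 0 < l u ∧
        chartMetric g x₀ (γ t) u u < -ν * l u ^ 2 := by
  set f : ℝ → EuclideanSpace ℝ (Fin n) := fun t ↦ extChartAt (𝓡∂ n) x₀ (γ t) with hf
  set h : ℝ → ℝ := fun t ↦ l (f t) with hh
  have hAC : AbsolutelyContinuousOnInterval f c d :=
    (hγ.1.2 _ (IsManifold.chart_mem_maximalAtlas x₀) c d hac hcd.le hdb (hγU.mono_right hUs)).1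
  refine ⟨hAC, ?_⟩
  have hsub : Icc c d ⊆ Icc a b := Icc_subset_Icc hac hdb
  have hvel : ∀ᵐ t ∂(volume.restrict (Icc c d)), ∃ u, HasDerivAt f u t ∧ 0 < l u := by
    have h1 := ae_restrict_of_ae_restrict_of_subset hsub hγ.2
    rw [← restrict_Ioo_eq_restrict_Icc] at h1 ⊢
    filter_upwards [h1, ae_restrict_mem measurableSet_Ioo] with t ⟨v, hv, hvc⟩ ht
    have htU : γ t ∈ U := hγU (Ioo_subset_Icc_self ht)
    refine ⟨_, (hv.hasDerivWithinAt_chart (hUs htU)).hasDerivAt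
      (mem_of_superset (Icc_mem_nhds ht.1 ht.2) hsub), ?_⟩
    rw [← differential_comp_extChartAt (hUs htU)]
    exact hτ.differential_pos htU hvc
  have hderiv : ∀ᵐ t ∂(volume.restrict (Icc c d)), ∃ u, HasDerivAt h u t ∧ 0 < u := by
    filter_upwards [hvel] with t ⟨u, hu1, hu2⟩
    exact ⟨_, l.hasFDerivAt.comp_hasDerivAt t hu1, hu2⟩
  have hACh : AbsolutelyContinuousOnInterval h c d := hAC.clm_comp l
  have hmono : StrictMonoOn h (Icc c d) := by
    intro x hx y hy hxy
    refine (hACh.mono ?_).lt_of_ae_hasDerivAt_pos hxy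
      (ae_restrict_of_ae_restrict_of_subset (Icc_subset_Icc hx.1 hy.2) hderiv)
    rw [uIcc_of_le hxy.le, uIcc_of_le hcd.le]
    exact Icc_subset_Icc hx.1 hy.2
  have hcont : ContinuousOn h (Icc c d) := by
    have := hACh.continuousOn
    rwa [uIcc_of_le hcd.le] at this
  have hmaps : MapsTo h (Icc c d) (Icc (h c) (h d)) := fun t ht ↦
    ⟨hmono.monotoneOn (left_mem_Icc.2 hcd.le) ht ht.1,
      hmono.monotoneOn ht (right_mem_Icc.2 hcd.le) ht.2⟩
  set σ : ℝ → M := γ ∘ Function.invFunOn h (Icc c d) with hσ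
  have hσγ : ∀ t ∈ Icc c d, σ (h t) = γ t := fun t ht ↦
    congrArg γ (hmono.injOn.leftInvOn_invFunOn ht)
  obtain ⟨ν, hν, hae⟩ := hu U _ hτ c d hac hcd hdb hγU σ hσγ
  refine ⟨ν, hν, ?_⟩
  have hae' := ae_comp_of_injOn measurableSet_Icc measurableSet_Icc hcont hmono.injOn hmaps (by
    filter_upwards [hderiv] with t ⟨u, hu1, hu2⟩
    rw [hu1.deriv]
    exact hu2.ne') hae
  filter_upwards [hvel, hae', ae_restrict_mem measurableSet_Icc] with t ⟨u, hu1, hu2⟩ ⟨v, hv, hgv⟩ ht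
  refine ⟨u, hu1, hu2, ?_⟩
  have hsrc : σ (h t) ∈ (chartAt (EuclideanHalfSpace n) x₀).source := by
    rw [hσγ t ht]; exact hUs (hγU ht)
  have hd1 := hv.hasDerivWithinAt_chart hsrc
  have hd2 : HasDerivAt h (l u) t := l.hasFDerivAt.comp_hasDerivAt t hu1
  have hd3 : HasDerivWithinAt f (l u • chartComponents n x₀ (σ (h t)) v) (Icc c d) t := by
    refine (hd1.scomp t hd2.hasDerivWithinAt hmaps).congr (fun s hs ↦ ?_) ?_
    · simp only [hf, Function.comp_apply, hσγ s hs]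
    · simp only [hf, Function.comp_apply, hσγ t ht]
  have hueq : u = l u • chartComponents n x₀ (σ (h t)) v :=
    (uniqueDiffOn_Icc hcd t ht).eq_deriv _ hu1.hasDerivWithinAt hd3
  rw [← hσγ t ht]
  have hcomp : chartMetric g x₀ (σ (h t)) u u = l u ^ 2 * g.val (σ (h t)) v v := by
    rw [hueq]
    simp only [map_smul, _root_.smul_apply, smul_eq_mul, chartMetric_apply hsrc,
      chartVector_chartComponents hsrc]
    rw [← smul_eq_mul (l u) (l _), ← map_smul, ← hueq]
    ring
  rw [hcomp]
  nlinarith [mul_lt_mul_of_pos_left hgv (pow_pos hu2 2)]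

/-- Nearby points of an `H¹`-timelike curve are joined by a straight timelike segment in a chart. -/
theorem TimeOrientation.IsUniformlyTimelike.exists_segment [IsManifold (𝓡∂ n) r M]
    {γ : ℝ → M} {a b : ℝ} (hab : a < b) (hγ : o.IsFutureH1Causal r γ a b)
    (hu : o.IsUniformlyTimelike r γ a b) {t₀ : ℝ} (ht₀ : t₀ ∈ Icc a b) :
    ∃ δ > 0, ∀ c d, a ≤ c → c < d → d ≤ b → t₀ - δ < c → d < t₀ + δ →
      ∃ α : ℝ → M, o.IsPiecewiseSmoothTimelike r α c d ∧ α c = γ c ∧ α d = γ d := by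
  set x₀ := γ t₀ with hx₀
  set φ := extChartAt (𝓡∂ n) x₀ with hφ
  set G := chartMetric g x₀ with hG
  obtain ⟨T, U, hTT, hxU, hUs, hτ⟩ := o.exists_isTemporalOn_linear r x₀
  have hsrc : x₀ ∈ (chartAt (EuclideanHalfSpace n) x₀).source := mem_chart_source _ x₀
  have hLor := isLorentzianOn_chartMetric g hsrc
  -- a first neighbourhood of `t₀`, which determines `ν`
  have hcontγ : ContinuousWithinAt γ (Icc a b) t₀ := hγ.1.1 t₀ ht₀
  have hnear : ∀ V ∈ 𝓝 x₀, ∃ δ > 0, ∀ t ∈ Icc a b, |t - t₀| ≤ δ → γ t ∈ V := by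
    intro V hV
    obtain ⟨δ, hδ, hsub⟩ := Metric.mem_nhdsWithin_iff.1 (hcontγ hV)
    refine ⟨δ / 2, half_pos hδ, fun t ht htd ↦ hsub ⟨?_, ht⟩⟩
    rw [Metric.mem_ball, Real.dist_eq]
    linarith
  obtain ⟨δ₁, hδ₁, hγU⟩ := hnear U (hτ.1.mem_nhds hxU)
  set c₀ := max a (t₀ - δ₁) with hc₀
  set d₀ := min b (t₀ + δ₁) with hd₀
  have hcd₀ : c₀ < d₀ := by
    rw [hc₀, hd₀, max_lt_iff, lt_min_iff, lt_min_iff]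
    refine ⟨⟨hab, ?_⟩, ?_, ?_⟩ <;> linarith [ht₀.1, ht₀.2]
  have hmapsU : MapsTo γ (Icc c₀ d₀) U := fun t ht ↦ hγU t
    ⟨(le_max_left _ _).trans ht.1, ht.2.trans (min_le_left _ _)⟩ (abs_le.2
    ⟨by linarith [(le_max_right a (t₀ - δ₁)).trans ht.1],
      by linarith [ht.2.trans (min_le_right b (t₀ + δ₁))]⟩)
  obtain ⟨hAC, ν, hν, hvel⟩ := hu.exists_chart_velocity_bound (l := -(G x₀ T)) hγ
    (le_max_left _ _) hcd₀ (min_le_left _ _) hUs hmapsU hτ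
  -- a second one, on which the metric is so close to its value at `x₀` that half of `ν` remains
  obtain ⟨ε, hε, hstable⟩ := hLor.exists_stable hTT hν
  let N : Set M := {p | p ∈ U ∧ ∀ u, |G p u u - G x₀ u u| ≤ ε * ‖u‖ ^ 2}
  have hN : N ∈ 𝓝 x₀ := inter_mem (hτ.1.mem_nhds hxU)
    (eventually_abs_sub_le (continuousAt_chartMetric g x₀) hε)
  -- a convex piece of the chart, in coordinates
  have hsymm : φ.target ∩ φ.symm ⁻¹' N ∈ 𝓝[range (𝓡∂ n)] (φ x₀) := by
    have h1 : Tendsto φ.symm (𝓝[range (𝓡∂ n)] (φ x₀)) (𝓝 x₀) := by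
      have := (continuousAt_extChartAt_symm (I := 𝓡∂ n) x₀).tendsto
      rw [extChartAt_to_inv] at this
      exact this.mono_left nhdsWithin_le_nhds
    exact inter_mem (extChartAt_target_mem_nhdsWithin (I := 𝓡∂ n) x₀) (h1 hN)
  obtain ⟨ρ, hρ, hball⟩ := Metric.mem_nhdsWithin_iff.1 hsymm
  obtain ⟨δ₂, hδ₂, hγN⟩ := hnear _ (inter_mem hN
    ((continuousAt_extChartAt (I := 𝓡∂ n) x₀).preimage_mem_nhds (Metric.ball_mem_nhds _ hρ)))
  refine ⟨min δ₁ δ₂, lt_min hδ₁ hδ₂, fun c d hac hcd hdb hct hdt ↦ ?_⟩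
  have hmin1 := min_le_left δ₁ δ₂
  have hmin2 := min_le_right δ₁ δ₂
  have hsub₀ : Icc c d ⊆ Icc c₀ d₀ := Icc_subset_Icc (max_le hac (by linarith))
    (le_min hdb (by linarith))
  have hIcc : ∀ t ∈ Icc c d, γ t ∈ N ∧ φ (γ t) ∈ Metric.ball (φ x₀) ρ :=
    fun t ht ↦ hγN t ⟨hac.trans ht.1, ht.2.trans hdb⟩
    (abs_le.2 ⟨by linarith [ht.1], by linarith [ht.2]⟩)
  -- the displacement
  have hdisp := hLor.displacement_timelike (ν := ν / 2) hTT hcd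
    (hAC.mono (by rwa [uIcc_of_le hcd.le, uIcc_of_le hcd₀.le])) (by
      filter_upwards [ae_restrict_of_ae_restrict_of_subset hsub₀ hvel,
        ae_restrict_mem measurableSet_Icc] with t ⟨u, hu1, hu2, hu3⟩ ht
      simp only [_root_.neg_apply, neg_sq, Left.neg_pos_iff] at hu2 hu3
      exact ⟨u, hu1, hu2, (hstable _ (hIcc t ht).1.2 u).2.1 hu3.le⟩)
  set w₀ := φ (γ d) - φ (γ c) with hw₀
  change G x₀ T w₀ < 0 ∧ G x₀ w₀ w₀ ≤ -(ν / 2) * G x₀ T w₀ ^ 2 at hdisp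
  obtain ⟨hw1, hw2⟩ := hdisp
  have hcd' : 0 < d - c := sub_pos.2 hcd
  set w := (d - c)⁻¹ • w₀ with hw
  -- the straight segment stays in the convex piece of the chart
  have hseg : ∀ t ∈ Icc c d, φ (γ c) + (t - c) • w ∈ φ.target ∩ φ.symm ⁻¹' N := by
    intro t ht
    have hc := hIcc c (left_mem_Icc.2 hcd.le)
    have hd := hIcc d (right_mem_Icc.2 hcd.le)
    have hconv : Convex ℝ (Metric.ball (φ x₀) ρ ∩ range (𝓡∂ n)) :=
      (convex_ball _ _).inter (𝓡∂ n).convex_range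
    have hmem : ∀ p, φ p ∈ range (𝓡∂ n) := fun p ↦ mem_range_self _
    have := hconv.add_smul_sub_mem ⟨hc.2, hmem _⟩ ⟨hd.2, hmem _⟩
      (t := (t - c) * (d - c)⁻¹) ⟨by have := sub_nonneg.2 ht.1; positivity, by
        rw [← div_eq_mul_inv, div_le_one hcd']; linarith [ht.2]⟩
    rw [mul_smul] at this
    exact hball this
  refine ⟨fun t ↦ φ.symm (φ (γ c) + (t - c) • w),
    o.isPiecewiseSmoothTimelike_segment hcd (fun t ht ↦ (hseg t ht).1) fun t ht ↦ ?_, ?_, ?_⟩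
  · obtain ⟨-, hpN⟩ := hseg t ht
    set p := φ.symm (φ (γ c) + (t - c) • w) with hp
    obtain ⟨hpU, hpG⟩ : p ∈ N := hpN
    have hps := hUs hpU
    -- the negative gradient `-z` of the temporal function is a future timelike vector at `p`
    obtain ⟨z, hz, hzc⟩ := hτ.2.2 p hpU
    have hw₀c : chartVector n x₀ p w₀ ∈ o.cone p := by
      refine o.mem_cone_of_neg hzc ?_ ?_
      · rw [← chartMetric_apply hps]
        change G p w₀ w₀ < 0
        exact (hstable _ hpG w₀).2.2 hw2 hw1.ne
      · have h1 : g.val p z (chartVector n x₀ p w₀) = differential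
          (fun p ↦ (-(chartMetric g x₀ x₀ T)) (extChartAt (𝓡∂ n) x₀ p)) p
            (chartVector n x₀ p w₀) := hz _
        rw [differential_comp_extChartAt hps, chartComponents_chartVector hps] at h1
        rw [map_neg, _root_.neg_apply, h1, _root_.neg_apply, neg_neg]
        exact hw1
    rw [hw, map_smul]
    exact o.smul_mem_cone hw₀c (inv_pos.2 hcd')
  · simp only [sub_self, zero_smul, add_zero]
    exact φ.left_inv (by simpa [hφ] using hUs (hIcc c (left_mem_Icc.2 hcd.le)).1.1)
  · simp only [hw, smul_inv_smul₀ hcd'.ne', hw₀, add_sub_cancel]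
    exact φ.left_inv (by simpa [hφ] using hUs (hIcc d (right_mem_Icc.2 hcd.le)).1.1)

/-! ### From `H¹`-timelike to piecewise smooth curves -/

theorem TimeOrientation.IsUniformlyTimelike.exists_isPiecewiseSmoothTimelike
    [IsManifold (𝓡∂ n) r M] {γ : ℝ → M} {a b : ℝ} (hab : a < b)
    (hγ : o.IsFutureH1Causal r γ a b) (hu : o.IsUniformlyTimelike r γ a b) :
    ∃ α : ℝ → M, α a = γ a ∧ α b = γ b ∧ o.IsPiecewiseSmoothTimelike r α a b := by
  choose δ hδ H using fun t₀ : Icc a b ↦ hu.exists_segment hab hγ t₀.2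
  obtain ⟨t, ht0, htm, ⟨k, hk⟩, hcov⟩ := exists_monotone_Icc_subset_open_cover_Icc (a := a) (b := b)
    (c := fun t₀ : Icc a b ↦ {s : Icc a b | (t₀ : ℝ) - δ t₀ < s ∧ (s : ℝ) < t₀ + δ t₀}) hab.le
    (fun t₀ ↦ (isOpen_lt continuous_const continuous_subtype_val).inter
      (isOpen_lt continuous_subtype_val continuous_const))
    (fun s _ ↦ mem_iUnion.2 ⟨s, by linarith [hδ s], by linarith [hδ s]⟩)
  have key : ∀ i, (t i : ℝ) = a ∨ a < t i ∧ ∃ α : ℝ → M, α a = γ a ∧ α (t i) = γ (t i) ∧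
      o.IsPiecewiseSmoothTimelike r α a (t i) := by
    intro i
    induction i with
    | zero => exact Or.inl ht0
    | succ i ih =>
      have hle : (t i : ℝ) ≤ t (i + 1) := htm (Nat.le_succ i)
      rcases hle.eq_or_lt with heq | hlt
      · rwa [← heq]
      obtain ⟨t₀, ht₀⟩ := hcov i
      obtain ⟨β, hβ, hβ1, hβ2⟩ := H t₀ (t i) (t (i + 1)) (t i).2.1 hlt (t (i + 1)).2.2
        (ht₀ (left_mem_Icc.2 (htm (Nat.le_succ i)))).1
        (ht₀ (right_mem_Icc.2 (htm (Nat.le_succ i)))).2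
      refine Or.inr ⟨(t i).2.1.trans_lt hlt, ?_⟩
      rcases ih with h0 | ⟨hai, α, hα1, hα2, hα⟩
      · rw [h0] at hβ hβ1
        exact ⟨β, hβ1, hβ2, hβ⟩
      · exact ⟨_, by simp [hai.le, hα1], by simp [hβ2, hlt.not_ge], hα.concat hβ (hα2.trans hβ1.symm)⟩
  rcases key k with h | ⟨-, h⟩
  · exact absurd ((hk k le_rfl).symm.trans h) hab.ne'
  · rwa [hk k le_rfl] at h

/-! ### From piecewise smooth to `H¹`-timelike curves -/

/-- A property of intervals that is inherited by unions of adjacent intervals holds on all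
subintervals of a partitioned interval if it holds on those of each piece. -/
theorem interval_induction_on_partition {P : ℝ → ℝ → Prop} {k : ℕ} {t : ℕ → ℝ}
    (hpiece : ∀ i < k, ∀ c d, t i ≤ c → c < d → d ≤ t (i + 1) → P c d)
    (hadd : ∀ c m d, c < m → m < d → P c m → P m d → P c d) :
    ∀ c d, t 0 ≤ c → c < d → d ≤ t k → P c d := by
  induction k with
  | zero => exact fun c d h1 h2 h3 ↦ absurd (h1.trans_lt h2) h3.not_gt
  | succ k ih =>
    have ih' := ih fun i hi ↦ hpiece i (by omega)
    intro c d h1 h2 h3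
    rcases le_or_gt d (t k) with hd | hd
    · exact ih' c d h1 h2 hd
    rcases le_or_gt (t k) c with hc | hc
    · exact hpiece k (by omega) c d hc h2 h3
    · exact hadd c (t k) d hc hd (ih' c _ h1 hc le_rfl) (hpiece k (by omega) _ d le_rfl hd h3)

theorem lipschitzOnWith_Icc_union {E : Type*} [PseudoMetricSpace E] {f : ℝ → E} {c m d : ℝ}
    {K L : NNReal} (hK : LipschitzOnWith K f (Icc c m)) (hL : LipschitzOnWith L f (Icc m d)) :
    LipschitzOnWith (max K L) f (Icc c d) := by
  have h : ∀ x ∈ Icc c d, ∀ y ∈ Icc c d, x ≤ y →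
      dist (f x) (f y) ≤ (max K L : NNReal) * dist x y := by
    intro x hx y hy hxy
    rcases le_total y m with hym | hym
    · exact (hK.weaken (le_max_left K L)).dist_le_mul x ⟨hx.1, hxy.trans hym⟩ y ⟨hy.1, hym⟩
    rcases le_total m x with hmx | hmx
    · exact (hL.weaken (le_max_right K L)).dist_le_mul x ⟨hmx, hx.2⟩ y ⟨hym, hy.2⟩
    · have h1 := (hK.weaken (le_max_left K L)).dist_le_mul x ⟨hx.1, hmx⟩ m ⟨hx.1.trans hmx, le_rfl⟩
      have h2 := (hL.weaken (le_max_right K L)).dist_le_mul m ⟨le_rfl, hym.trans hy.2⟩ y ⟨hym, hy.2⟩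
      have h3 : dist x y = dist x m + dist m y := by
        rw [Real.dist_eq, Real.dist_eq, Real.dist_eq, abs_of_nonpos, abs_of_nonpos, abs_of_nonpos]
          <;> linarith
      rw [h3, mul_add]
      exact (dist_triangle _ (f m) _).trans (add_le_add h1 h2)
  refine LipschitzOnWith.of_dist_le_mul fun x hx y hy ↦ ?_
  rcases le_total x y with hxy | hxy
  · exact h x hx y hy hxy
  · rw [dist_comm, dist_comm x y]
    exact h y hy x hx hxy

omit [NeZero n] in
theorem isH1On_of_lipschitzOnWith {f : ℝ → EuclideanSpace ℝ (Fin n)} {c d : ℝ} (hcd : c ≤ d)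
    {K : NNReal} (hf : LipschitzOnWith K f (Icc c d)) : IsH1On f c d := by
  refine ⟨LipschitzOnWith.absolutelyContinuousOnInterval (K := K) (by rwa [uIcc_of_le hcd]), ?_⟩
  refine MemLp.of_bound (stronglyMeasurable_deriv f).aestronglyMeasurable (K : ℝ) ?_
  rw [← restrict_Ioo_eq_restrict_Icc]
  filter_upwards [ae_restrict_mem measurableSet_Ioo] with t ht
  exact norm_deriv_le_of_lipschitzOn (Icc_mem_nhds ht.1 ht.2) hf

omit [IsManifold (𝓡∂ n) 1 M] in
theorem HasVelocityWithinAt.comp {α : ℝ → M} {k : ℝ → ℝ} {s : Set ℝ} {y c : ℝ}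
    {v : TangentSpace (𝓡∂ n) (α (k y))} (h : HasVelocityWithinAt α univ (k y) v)
    (hk : HasDerivAt k c y) : HasVelocityWithinAt (α ∘ k) s y (c • v) := by
  have h1 := HasMFDerivWithinAt.comp y h hk.hasDerivWithinAt.hasFDerivWithinAt.hasMFDerivWithinAt
    (subset_preimage_univ (s := s))
  refine HasMFDerivWithinAt.congr_mfderiv h1 ?_
  ext
  change ((1 : ℝ) • c) • v = (1 : ℝ) • (c • v)
  simp

omit [IsManifold (𝓡∂ n) 1 M] in
theorem HasVelocityWithinAt.univ_of_mem_nhds {α : ℝ → M} {s : Set ℝ} {t : ℝ}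
    {v : TangentSpace (𝓡∂ n) (α t)} (h : HasVelocityWithinAt α s t v) (hs : s ∈ 𝓝 t) :
    HasVelocityWithinAt α univ t v :=
  (HasMFDerivWithinAt.hasMFDerivAt h hs).hasMFDerivWithinAt

omit [IsManifold (𝓡∂ n) 1 M] in
theorem HasVelocityWithinAt.mono {α : ℝ → M} {s s' : Set ℝ} {t : ℝ}
    {v : TangentSpace (𝓡∂ n) (α t)} (h : HasVelocityWithinAt α s t v) (hs : s' ⊆ s) :
    HasVelocityWithinAt α s' t v :=
  HasMFDerivWithinAt.mono h hs

omit [IsManifold (𝓡∂ n) 1 M] in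
theorem HasVelocityWithinAt.mfderivWithin_one {α : ℝ → M} {c d t : ℝ} (hcd : c < d)
    (ht : t ∈ Icc c d) {v : TangentSpace (𝓡∂ n) (α t)}
    (h : HasVelocityWithinAt α (Icc c d) t v) :
    mfderivWithin 𝓘(ℝ, ℝ) (𝓡∂ n) α (Icc c d) t (1 : ℝ) = v := by
  have := HasMFDerivWithinAt.mfderivWithin h
    (uniqueMDiffWithinAt_iff_uniqueDiffWithinAt.2 (uniqueDiffOn_Icc hcd t ht))
  rw [this]
  exact one_smul ℝ v

/-- The squared length of the velocity is continuous along a `C¹` curve. -/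
theorem continuousOn_val_velocity {α : ℝ → M} {c d : ℝ} (hcd : c < d)
    (hα : ContMDiffOn 𝓘(ℝ, ℝ) (𝓡∂ n) 1 α (Icc c d)) :
    ContinuousOn (fun t ↦ g.val (α t) (mfderivWithin 𝓘(ℝ, ℝ) (𝓡∂ n) α (Icc c d) t (1 : ℝ))
      (mfderivWithin 𝓘(ℝ, ℝ) (𝓡∂ n) α (Icc c d) t (1 : ℝ))) (Icc c d) := by
  have huniq : UniqueMDiffOn 𝓘(ℝ, ℝ) (Icc c d) :=
    uniqueMDiffOn_iff_uniqueDiffOn.2 (uniqueDiffOn_Icc hcd)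
  have h1 := hα.continuousOn_tangentMapWithin le_rfl huniq
  have hone : Continuous fun t : ℝ ↦ (⟨t, (1 : ℝ)⟩ : TangentBundle 𝓘(ℝ, ℝ) ℝ) :=
    (tangentBundleModelSpaceHomeomorph 𝓘(ℝ, ℝ)).symm.continuous.comp
      (continuous_id.prodMk continuous_const : Continuous fun t : ℝ ↦ (t, (1 : ℝ)))
  have h2 : ContinuousOn (fun t ↦ (⟨α t, mfderivWithin 𝓘(ℝ, ℝ) (𝓡∂ n) α (Icc c d) t (1 : ℝ)⟩ :
      TangentBundle (𝓡∂ n) M)) (Icc c d) :=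
    h1.comp hone.continuousOn (fun t ht ↦ ht)
  have h3 := (g.contMDiff.continuous.comp_continuousOn hα.continuousOn).clm_bundle_apply₂
    (F₃ := ℝ) (E₃ := Bundle.Trivial M ℝ) h2 h2
  intro t ht
  have h4 := h3 t ht
  rw [FiberBundle.continuousWithinAt_totalSpace] at h4
  exact h4.2

section Converse

variable {α : ℝ → M} {k : ℕ} {t : ℕ → ℝ}

omit [IsManifold (𝓡∂ n) 1 M] in
theorem exists_lipschitzOnWith_chart (hr : 1 ≤ r)
    (ht : ∀ i < k, ContMDiffOn 𝓘(ℝ, ℝ) (𝓡∂ n) r α (Icc (t i) (t (i + 1))))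
    {e : OpenPartialHomeomorph M (EuclideanHalfSpace n)}
    (he : e ∈ IsManifold.maximalAtlas (𝓡∂ n) r M) {c d : ℝ} (hc : t 0 ≤ c) (hcd : c < d)
    (hd : d ≤ t k) (hmaps : MapsTo α (Icc c d) e.source) :
    ∃ K, LipschitzOnWith K (fun s ↦ e.extend (𝓡∂ n) (α s)) (Icc c d) := by
  revert hmaps
  refine interval_induction_on_partition (k := k) (t := t) (P := fun c d ↦
    MapsTo α (Icc c d) e.source → ∃ K, LipschitzOnWith K (fun s ↦ e.extend (𝓡∂ n) (α s)) (Icc c d))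
    (fun i hi c d hc hcd hd hmaps ↦ ?_) (fun c m d hcm hmd h1 h2 hmaps ↦ ?_) c d hc hcd hd
  · have h1 := (e.contMDiffOn_extend he).comp ((ht i hi).mono (Icc_subset_Icc hc hd)) hmaps
    have h2 := (contMDiffOn_iff_contDiffOn.1 h1).of_le (m := 1) (by exact_mod_cast hr)
    exact h2.exists_lipschitzOnWith one_ne_zero (convex_Icc _ _) isCompact_Icc
  · obtain ⟨K, hK⟩ := h1 (hmaps.mono_left (Icc_subset_Icc_right hmd.le))
    obtain ⟨L, hL⟩ := h2 (hmaps.mono_left (Icc_subset_Icc_left hcm.le))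
    exact ⟨_, lipschitzOnWith_Icc_union hK hL⟩

omit [IsManifold (𝓡∂ n) 1 M] in
theorem continuousOn_of_partition (hlt : t 0 < t k)
    (ht : ∀ i < k, ContMDiffOn 𝓘(ℝ, ℝ) (𝓡∂ n) r α (Icc (t i) (t (i + 1)))) :
    ContinuousOn α (Icc (t 0) (t k)) := by
  refine interval_induction_on_partition (k := k) (t := t) (P := fun c d ↦ ContinuousOn α (Icc c d))
    (fun i hi c d hc hcd hd ↦ ?_) (fun c m d hcm hmd h1 h2 ↦ ?_) _ _ le_rfl hlt le_rfl
  · exact (ht i hi).continuousOn.mono (Icc_subset_Icc hc hd)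
  · rw [← Icc_union_Icc_eq_Icc hcm.le hmd.le]
    exact h1.union_of_isClosed h2 isClosed_Icc isClosed_Icc

/-- Off finitely many parameters, a piecewise smooth timelike curve has a two-sided timelike
velocity. -/
theorem exists_finite_velocity (hlt : t 0 < t k)
    (ht : ∀ i < k, ∀ s ∈ Icc (t i) (t (i + 1)), ∃ v : TangentSpace (𝓡∂ n) (α s),
      HasVelocityWithinAt α (Icc (t i) (t (i + 1))) s v ∧ v ∈ o.cone (α s)) :
    ∃ F : Set ℝ, F.Finite ∧ ∀ s ∈ Icc (t 0) (t k) \ F, ∃ v : TangentSpace (𝓡∂ n) (α s),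
      HasVelocityWithinAt α univ s v ∧ v ∈ o.cone (α s) := by
  refine interval_induction_on_partition (k := k) (t := t) (P := fun c d ↦
    ∃ F : Set ℝ, F.Finite ∧ ∀ s ∈ Icc c d \ F, ∃ v : TangentSpace (𝓡∂ n) (α s),
      HasVelocityWithinAt α univ s v ∧ v ∈ o.cone (α s))
    (fun i hi c d hc hcd hd ↦ ?_) (fun c m d hcm hmd h1 h2 ↦ ?_) _ _ le_rfl hlt le_rfl
  · refine ⟨{c, d}, by simp, fun s hs ↦ ?_⟩
    obtain ⟨v, hv, hvc⟩ := ht i hi s ⟨hc.trans hs.1.1, hs.1.2.trans hd⟩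
    have h1 : c < s := lt_of_le_of_ne hs.1.1 fun h ↦ hs.2 (by simp [h])
    have h2 : s < d := lt_of_le_of_ne hs.1.2 fun h ↦ hs.2 (by simp [h])
    exact ⟨v, hv.univ_of_mem_nhds (Icc_mem_nhds (hc.trans_lt h1) (h2.trans_le hd)), hvc⟩
  · obtain ⟨F₁, hF₁, h1⟩ := h1
    obtain ⟨F₂, hF₂, h2⟩ := h2
    refine ⟨F₁ ∪ F₂, hF₁.union hF₂, fun s hs ↦ ?_⟩
    rcases le_total s m with hsm | hsm
    · exact h1 s ⟨⟨hs.1.1, hsm⟩, fun h ↦ hs.2 (Or.inl h)⟩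
    · exact h2 s ⟨⟨hsm, hs.1.2⟩, fun h ↦ hs.2 (Or.inr h)⟩

/-- A temporal function strictly increases along a piecewise smooth timelike curve, and the squared
length of the velocity is at most `-ν` times the square of its rate of increase. -/
theorem TimeOrientation.IsTemporalOn.strictMonoOn_and_bound (hr : 1 ≤ r) {U : Set M} {τ : M → ℝ}
    (hτ : o.IsTemporalOn r τ U)
    (ht : ∀ i < k, ContMDiffOn 𝓘(ℝ, ℝ) (𝓡∂ n) r α (Icc (t i) (t (i + 1))) ∧
      ∀ s ∈ Icc (t i) (t (i + 1)), ∃ v : TangentSpace (𝓡∂ n) (α s),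
        HasVelocityWithinAt α (Icc (t i) (t (i + 1))) s v ∧ v ∈ o.cone (α s))
    {c d : ℝ} (hc : t 0 ≤ c) (hcd : c < d) (hd : d ≤ t k) (hmaps : MapsTo α (Icc c d) U) :
    StrictMonoOn (fun s ↦ τ (α s)) (Icc c d) ∧ ∃ ν > 0, ∃ F : Set ℝ, F.Finite ∧
      ∀ s ∈ Icc c d \ F, ∃ v : TangentSpace (𝓡∂ n) (α s), HasVelocityWithinAt α univ s v ∧
        v ∈ o.cone (α s) ∧ g.val (α s) v v < -ν * differential τ (α s) v ^ 2 := by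
  revert hmaps
  refine interval_induction_on_partition (k := k) (t := t) (P := fun c d ↦
    MapsTo α (Icc c d) U →
    StrictMonoOn (fun s ↦ τ (α s)) (Icc c d) ∧ ∃ ν > 0, ∃ F : Set ℝ, F.Finite ∧
      ∀ s ∈ Icc c d \ F, ∃ v : TangentSpace (𝓡∂ n) (α s), HasVelocityWithinAt α univ s v ∧
        v ∈ o.cone (α s) ∧ g.val (α s) v v < -ν * differential τ (α s) v ^ 2)
    (fun i hi c d hc hcd hd hmaps ↦ ?_) (fun c m d hcm hmd h1 h2 hmaps ↦ ?_) c d hc hcd hd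
  · obtain ⟨hsm, hvel⟩ := ht i hi
    have hsub : Icc c d ⊆ Icc (t i) (t (i + 1)) := Icc_subset_Icc hc hd
    set V : ∀ s, TangentSpace (𝓡∂ n) (α s) :=
      fun s ↦ mfderivWithin 𝓘(ℝ, ℝ) (𝓡∂ n) α (Icc c d) s (1 : ℝ) with hV
    have hV' : ∀ s ∈ Icc c d, HasVelocityWithinAt α (Icc c d) s (V s) ∧ V s ∈ o.cone (α s) ∧
        (s ∈ Ioo c d → HasVelocityWithinAt α univ s (V s)) := by
      intro s hs
      obtain ⟨v, hv, hvc⟩ := hvel s (hsub hs)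
      have hv' := hv.mono hsub
      have hVv : V s = v := hv'.mfderivWithin_one hcd hs
      rw [hVv]
      exact ⟨hv', hvc, fun hs' ↦ hv'.univ_of_mem_nhds (Icc_mem_nhds hs'.1 hs'.2)⟩
    have hmd : ∀ s ∈ Icc c d, MDifferentiableAt (𝓡∂ n) 𝓘(ℝ, ℝ) τ (α s) := fun s hs ↦
      (hτ.2.1.contMDiffAt (hτ.1.mem_nhds (hmaps hs))).mdifferentiableAt
        (by simpa using (zero_lt_one.trans_le hr).ne')
    have hder : ∀ s ∈ Icc c d, HasDerivWithinAt (fun s ↦ τ (α s))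
        (differential τ (α s) (V s)) (Icc c d) s := fun s hs ↦
      (hV' s hs).1.hasDerivWithinAt_comp (hmd s hs)
    have hpos : ∀ s ∈ Icc c d, 0 < differential τ (α s) (V s) := fun s hs ↦
      hτ.differential_pos (hmaps hs) (o.futureCausal_of_mem_cone (hV' s hs).2.1)
    have hC1 : ContDiffOn ℝ 1 (fun s ↦ τ (α s)) (Icc c d) :=
      (contMDiffOn_iff_contDiffOn.1 (hτ.2.1.comp (hsm.mono hsub) hmaps)).of_le
        (by exact_mod_cast hr)
    refine ⟨strictMonoOn_of_deriv_pos (convex_Icc _ _) hC1.continuousOn fun s hs ↦ ?_, ?_⟩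
    · rw [interior_Icc] at hs
      rw [((hder s (Ioo_subset_Icc_self hs)).hasDerivAt (Icc_mem_nhds hs.1 hs.2)).deriv]
      exact hpos s (Ioo_subset_Icc_self hs)
    have hD : ContinuousOn (fun s ↦ differential τ (α s) (V s)) (Icc c d) := by
      refine (hC1.continuousOn_derivWithin (uniqueDiffOn_Icc hcd) le_rfl).congr fun s hs ↦ ?_
      exact ((hder s hs).derivWithin (uniqueDiffOn_Icc hcd s hs)).symm
    have hQ : ContinuousOn (fun s ↦ g.val (α s) (V s) (V s)) (Icc c d) :=
      continuousOn_val_velocity hcd ((hsm.mono hsub).of_le (by exact_mod_cast hr))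
    obtain ⟨s₀, hs₀, hmax⟩ := isCompact_Icc.exists_isMaxOn (nonempty_Icc.2 hcd.le)
      (hQ.div (hD.pow 2) fun s hs ↦ (pow_pos (hpos s hs) 2).ne')
    set q := g.val (α s₀) (V s₀) (V s₀) / differential τ (α s₀) (V s₀) ^ 2 with hq
    have hq0 : q < 0 := div_neg_of_neg_of_pos (o.timelike_of_mem_cone (hV' s₀ hs₀).2.1)
      (pow_pos (hpos s₀ hs₀) 2)
    refine ⟨-q / 2, by linarith, {c, d}, by simp, fun s hs ↦ ⟨V s, ?_, (hV' s hs.1).2.1, ?_⟩⟩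
    · refine (hV' s hs.1).2.2 ⟨lt_of_le_of_ne hs.1.1 fun h ↦ hs.2 (by simp [h]),
        lt_of_le_of_ne hs.1.2 fun h ↦ hs.2 (by simp [h])⟩
    · have h1 : g.val (α s) (V s) (V s) / differential τ (α s) (V s) ^ 2 ≤ q := hmax hs.1
      have h2 : 0 < differential τ (α s) (V s) ^ 2 := pow_pos (hpos s hs.1) 2
      rw [div_le_iff₀ h2] at h1
      nlinarith
  · obtain ⟨hmono₁, ν₁, hν₁, F₁, hF₁, h1⟩ := h1 (hmaps.mono_left (Icc_subset_Icc_right hmd.le))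
    obtain ⟨hmono₂, ν₂, hν₂, F₂, hF₂, h2⟩ := h2 (hmaps.mono_left (Icc_subset_Icc_left hcm.le))
    refine ⟨?_, min ν₁ ν₂, lt_min hν₁ hν₂, F₁ ∪ F₂, hF₁.union hF₂, fun s hs ↦ ?_⟩
    · rw [← Icc_union_Icc_eq_Icc hcm.le hmd.le]
      exact hmono₁.union hmono₂ (isGreatest_Icc hcm.le) (isLeast_Icc hmd.le)
    rcases le_total s m with hsm | hsm
    · obtain ⟨v, hv, hvc, hb⟩ := h1 s ⟨⟨hs.1.1, hsm⟩, fun h ↦ hs.2 (Or.inl h)⟩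
      refine ⟨v, hv, hvc, hb.trans_le ?_⟩
      gcongr
      exact min_le_left _ _
    · obtain ⟨v, hv, hvc, hb⟩ := h2 s ⟨⟨hsm, hs.1.2⟩, fun h ↦ hs.2 (Or.inr h)⟩
      refine ⟨v, hv, hvc, hb.trans_le ?_⟩
      gcongr
      exact min_le_right _ _

theorem TimeOrientation.IsPiecewiseSmoothTimelike.isFutureH1Causal (hr : 1 ≤ r) {a b : ℝ}
    (hab : a < b) (hα : o.IsPiecewiseSmoothTimelike r α a b) : o.IsFutureH1Causal r α a b := by
  obtain ⟨k, t, rfl, rfl, ht⟩ := hα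
  refine ⟨⟨continuousOn_of_partition hab fun i hi ↦ (ht i hi).2.1,
    fun e he c d hc hcd hd hmaps ↦ ?_⟩, ?_⟩
  · rcases hcd.eq_or_lt with rfl | hcd
    · exact isH1On_of_lipschitzOnWith le_rfl (K := 0) (by simp)
    · obtain ⟨K, hK⟩ := exists_lipschitzOnWith_chart hr (fun i hi ↦ (ht i hi).2.1) he hc hcd hd hmaps
      exact isH1On_of_lipschitzOnWith hcd.le hK
  · obtain ⟨F, hF, hv⟩ := exists_finite_velocity hab fun i hi ↦ (ht i hi).2.2
    have hF' : ∀ᵐ s ∂(volume.restrict (Icc (t 0) (t k))), s ∉ F :=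
      ae_restrict_of_ae (measure_eq_zero_iff_ae_notMem.1 (hF.measure_zero volume))
    filter_upwards [hF', ae_restrict_mem measurableSet_Icc] with s hsF hs
    obtain ⟨v, hv, hvc⟩ := hv s ⟨hs, hsF⟩
    exact ⟨v, hv.mono (subset_univ _), o.futureCausal_of_mem_cone hvc⟩

theorem TimeOrientation.IsPiecewiseSmoothTimelike.isUniformlyTimelike (hr : 1 ≤ r) {a b : ℝ}
    (hab : a < b) (hα : o.IsPiecewiseSmoothTimelike r α a b) : o.IsUniformlyTimelike r α a b := by
  obtain ⟨k, t, rfl, rfl, ht⟩ := hα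
  intro U τ hτ c d hc hcd hd hmaps σ hσ
  obtain ⟨hmono, ν, hν, F, hF, hvel⟩ := hτ.strictMonoOn_and_bound hr
    (fun i hi ↦ (ht i hi).2) hc hcd hd hmaps
  set f : ℝ → ℝ := fun s ↦ τ (α s) with hf
  refine ⟨ν, hν, ?_⟩
  have hcont : ContinuousOn f (Icc c d) :=
    (hτ.2.1.continuousOn).comp ((continuousOn_of_partition hab fun i hi ↦ (ht i hi).2.1).mono
      (Icc_subset_Icc hc hd)) hmaps
  have himage : f '' Icc c d = Icc (f c) (f d) :=
    (hcont.image_Icc_of_monotoneOn hcd.le hmono.monotoneOn)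
  set h := Function.invFunOn f (Icc c d) with hh
  have hright : ∀ y ∈ Icc (f c) (f d), h y ∈ Icc c d ∧ f (h y) = y := fun y hy ↦
    Function.invFunOn_pos (himage.ge hy)
  have hleft : ∀ s ∈ Icc c d, h (f s) = s := fun s hs ↦ hmono.injOn.leftInvOn_invFunOn hs
  have hmonoh : StrictMonoOn h (Icc (f c) (f d)) := by
    intro x hx y hy hxy
    rw [← (hright x hx).2, ← (hright y hy).2] at hxy
    exact (hmono.lt_iff_lt (hright x hx).1 (hright y hy).1).1 hxy
  have himageh : h '' Icc (f c) (f d) = Icc c d := by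
    ext s
    refine ⟨?_, fun hs ↦ ⟨f s, himage ▸ mem_image_of_mem f hs, hleft s hs⟩⟩
    rintro ⟨y, hy, rfl⟩
    exact (hright y hy).1
  have hnull : ∀ᵐ y ∂(volume.restrict (Icc (f c) (f d))), y ∉ f '' (F ∪ {c, d}) :=
    ae_restrict_of_ae (measure_eq_zero_iff_ae_notMem.1
      (((hF.union (by simp)).image f).measure_zero volume))
  filter_upwards [hnull, ae_restrict_mem measurableSet_Icc] with y hyF hy
  obtain ⟨hhy, hfh⟩ := hright y hy
  have hnot : h y ∉ F ∪ {c, d} := fun hmem ↦ hyF ⟨h y, hmem, hfh⟩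
  have hhc : c < h y := lt_of_le_of_ne hhy.1 fun e ↦ hnot (by simp [← e])
  have hhd : h y < d := lt_of_le_of_ne hhy.2 fun e ↦ hnot (by simp [e])
  have hynhds : Icc (f c) (f d) ∈ 𝓝 y := by
    rw [← hfh]
    exact Icc_mem_nhds (hmono (left_mem_Icc.2 hcd.le) hhy hhc)
      (hmono hhy (right_mem_Icc.2 hcd.le) hhd)
  obtain ⟨v, hv, hvc, hgv⟩ := hvel (h y) ⟨hhy, fun e ↦ hnot (Or.inl e)⟩
  have hpos : 0 < differential τ (α (h y)) v :=
    hτ.differential_pos (hmaps hhy) (o.futureCausal_of_mem_cone hvc)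
  have hfder : HasDerivAt f (differential τ (α (h y)) v) (h y) := by
    have hmd : MDifferentiableAt (𝓡∂ n) 𝓘(ℝ, ℝ) τ (α (h y)) :=
      (hτ.2.1.contMDiffAt (hτ.1.mem_nhds (hmaps hhy))).mdifferentiableAt
        (by simpa using (zero_lt_one.trans_le hr).ne')
    exact hasDerivWithinAt_univ.1 (hv.hasDerivWithinAt_comp hmd)
  have hhcont : ContinuousAt h y := hmonoh.continuousAt_of_image_mem_nhds hynhds (by
    rw [himageh]
    exact Icc_mem_nhds hhc hhd)
  have hhder : HasDerivAt h (differential τ (α (h y)) v)⁻¹ y :=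
    hfder.of_local_left_inverse hhcont hpos.ne' (by
      filter_upwards [hynhds] with z hz using (hright z hz).2)
  have heq : EqOn σ (α ∘ h) (Icc (f c) (f d)) := by
    intro z hz
    obtain ⟨hz1, hz2⟩ := hright z hz
    have := hσ (h z) hz1
    rwa [show τ (α (h z)) = z from hz2] at this
  refine exists_velocity_congr (P := fun p v ↦ g.val p v v < -ν) heq hy
    ⟨_, hv.comp hhder, ?_⟩
  change g.val (α (h y)) ((differential τ (α (h y)) v)⁻¹ • v)
    ((differential τ (α (h y)) v)⁻¹ • v) < -ν
  simp only [map_smul, _root_.smul_apply, smul_eq_mul]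
  rw [← mul_assoc, ← mul_inv, ← sq, inv_mul_lt_iff₀ (pow_pos hpos 2)]
  linarith

end Converse

end SpacetimeWithBoundary

theorem proposition2p11 (n : ℕ) [NeZero n] (hn : 2 ≤ n) (r : ℕ∞) (hr : 2 ≤ r)
    (M : Type*) [TopologicalSpace M] [T2Space M] [SecondCountableTopology M] [ConnectedSpace M]
    [ChartedSpace (EuclideanHalfSpace n) M]
    [IsManifold (𝓡∂ n) 1 M] [IsManifold (𝓡∂ n) r M]
    (g : SpacetimeWithBoundary.LorentzMetric n M) (hg : g.HasTimelikeBoundary)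
    (o : SpacetimeWithBoundary.TimeOrientation g) :
    (∀ (p q : M) (τ₀ τ₁ : ℝ) (γ : ℝ → M), τ₀ < τ₁ → γ τ₀ = p → γ τ₁ = q →
      o.IsFutureH1Causal r γ τ₀ τ₁ → o.IsUniformlyTimelike r γ τ₀ τ₁ →
        ∃ (a b : ℝ) (α : ℝ → M), a < b ∧ α a = p ∧ α b = q ∧
          o.IsPiecewiseSmoothTimelike r α a b) ∧
    (∀ p q : M, o.H1Chronological r p q ↔ o.Chronological r p q) := by
  have hr1 : 1 ≤ r := one_le_two.trans hr
  have forward : ∀ (p q : M) (τ₀ τ₁ : ℝ) (γ : ℝ → M), τ₀ < τ₁ → γ τ₀ = p → γ τ₁ = q →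
      o.IsFutureH1Causal r γ τ₀ τ₁ → o.IsUniformlyTimelike r γ τ₀ τ₁ →
        ∃ (a b : ℝ) (α : ℝ → M), a < b ∧ α a = p ∧ α b = q ∧
          o.IsPiecewiseSmoothTimelike r α a b := by
    rintro p q a b γ hab rfl rfl hγ hu
    obtain ⟨α, h⟩ := hu.exists_isPiecewiseSmoothTimelike hab hγ
    exact ⟨a, b, α, hab, h⟩
  refine ⟨forward, fun p q ↦ ⟨?_, ?_⟩⟩
  · rintro ⟨a, b, γ, hab, hp, hq, hγ, hu⟩
    exact forward p q a b γ hab hp hq hγ hu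
  · rintro ⟨a, b, α, hab, hp, hq, hα⟩
    exact ⟨a, b, α, hab, hp, hq, hα.isFutureH1Causal hr1 hab, hα.isUniformlyTimelike hr1 hab⟩
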